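/- Write $u,\tilde u,\hat u,\hat{\tilde u}$ for the values of a complex field at the vertices of a lattice square; the tilde-direction has parameter $p$ and the hat-direction has parameter $q$. Let the lattice parameters range over a set $\Lambda$, and consider the system $$h(u,\tilde u,p)=U\tilde U,\qquad h(u,\hat u,q)=U\hat U. \tag{1}$$ Here $h$ is affine-linear, of one of the two forms $h(u,\tilde u,p)=s_0(p)+s_1(p)u+s_2(p)\tilde u$ (with $s_1,s_2$ nowhere zero) or $h(u,\tilde u,p)=s_0(p)+s_3(p)u\tilde u$ (with $s_0,s_3$ nowhere zero), where the $s_i:\Lambda\to\mathbb C$ are arbitrary functions. A quadrilateral equation is an equation $Q(u,\tilde u,\hat u,\hat{\tilde u};p,q)=0$ with $Q$ a polynomial of degree at most one in each of $u,\tilde u,\hat u,\hat{\tilde u}$. The system (1), a $u$-equation $Q=0$ and a $U$-equation $F=0$ form a consistent triplet if, for $p\ne q$, the compatibility ($\hat{\tilde u}=\tilde{\hat u}$) of (1) with respect to $u$ is equivalent to $F(U,\tilde U,\hat U,\hat{\tilde U};p,q)=0$, and its compatibility with respect to $U$ is equivalent to $Q(u,\tilde u,\hat u,\hat{\tilde u};p,q)=0$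 (field values by which one divides in solving (1) being nonzero). An equation is consistent around the cube (CAC) if, for pairwise distinct $p,q,r$ and generic initial values $u,\tilde u,\hat u,\bar u$ on a cube with this equation on its six faces, every step is uniquely solvable and the three ways to calculate $\bar{\hat{\tilde u}}$ give the same value; it has the tetrahedron property if this value depends on $\tilde u,\hat u,\bar u$ only. Consider the following six systems; $p$ stands for the value of a function $\Lambda\to\mathbb C$ at the lattice parameter. 1. $\frac1p(u-\tilde u)=U\tilde U$ ($p\neq0$); $u$-equation $\mathrm{Q1}(0;p^2,q^2)$; $U$-equation lpmKdV. 2. $u+\tilde u+p=U\tilde U$; $u$-equation $\mathrm{H2}$; $U$-equation $\mathrm{H1}(2p,2q)$. 3. $\frac1p(u+\tilde u-\delta p^2)=U\tilde U$ ($p\ne0$); $u$-equation $\mathrm{A1}(\delta;p^2,q^2)$; $U$-equation $\mathrm{H3}(\delta;2p,2q)$. 4. $u\tilde u+\delta p=U\tilde U$ ($\delta\ne0$, $p\neq0$); $u$-equation $\mathrm{H3}(\delta)$; $U$-equation $\mathrm{H3}(-\delta)$. 5. $\frac1p(u\tilde u-1)=U\tilde U$ ($p\ne0$); $u$-equation $q^2(u\tilde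 u-1)(\hat u\hat{\tilde u}-1)=p^2(u\hat u-1)(\tilde u\hat{\tilde u}-1)$; $U$-equation $\mathrm{H3}(1)$ with $U$ replaced by $U^{-1}$ (denominators cleared). 6. $\frac1{\sqrt{1-p^2}}(1-pu\tilde u)=U\tilde U$ ($p\neq0$, $p^2\ne1$, any choice of the root for each $p$); $u$-equation $\mathrm{A2}$; $U$-equation $\mathrm{A2}(\sqrt{1-p^2},\sqrt{1-q^2})$. The equations named here, with parameters $p,q$ unless others are shown, are: - $\mathrm{H1}$: $(u-\hat{\tilde u})(\tilde u-\hat u)-p+q=0$. - $\mathrm{H2}$: $(u-\hat{\tilde u})(\tilde u-\hat u)-(p-q)(u+\tilde u+\hat u+\hat{\tilde u}+p+q)=0$. - $\mathrm{H3}(\delta)$: $p(u\tilde u+\hat u\hat{\tilde u})-q(u\hat u+\tilde u\hat{\tilde u})+\delta(p^2-q^2)=0$. - $\mathrm{A1}(\delta)$: $p(u+\hat u)(\tilde u+\hat{\tilde u})-q(u+\tilde u)(\hat u+\hat{\tilde u})-\delta^2pq(p-q)=0$. - $\mathrm{A2}$: $p(1-q^2)(u\tilde u+\hat u\hat{\tilde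 u})-q(1-p^2)(u\hat u+\tilde u\hat{\tilde u})-(p^2-q^2)(1+u\tilde u\hat u\hat{\tilde u})=0$. - $\mathrm{Q1}(\delta)$: $p(u-\hat u)(\tilde u-\hat{\tilde u})-q(u-\tilde u)(\hat u-\hat{\tilde u})+\delta^2pq(p-q)=0$. - lpmKdV: $p(U\tilde U-\hat U\hat{\tilde U})-q(U\hat U-\tilde U\hat{\tilde U})=0$. **Theorem.** (a) If distinct lattice parameters have distinct values $p$, each of the six systems is of one of the two forms and is, with its two listed equations, a consistent triplet; both equations are quadrilateral equations that are CAC and have the tetrahedron property. (b) Let $\Lambda$ be infinite. If a system (1) of one of the two forms, with quadrilateral equations $Q=0$ and $F=0$, is a consistent triplet and both equations are CAC, then the triplet is one of the six, for some function $\Lambda\to\mathbb C$ as the parameter $p$, up to invertible site-dependent changes $u\to au+b$, $U\to cU$ of the fields on the lattice with one direction for each parameter (which carry the system into the listed one, and $Q$ and $F$ into nonzero multiples of the listed polynomials); entry 5 may also occur with the roles of $u$ and $U$ interchanged. -/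

import Mathlib

/-- The left-hand side of a quadrilateral equation `Q(u, ũ, û, ũ̂) = 0`, as a function of the values
at the four vertices, listed in the order `u, ũ, û, ũ̂`. -/
abbrev QuadFn := ℂ → ℂ → ℂ → ℂ → ℂ

/-- `Q` is an affine-linear quadrilateral polynomial: a polynomial of degree at most one in each of
the four variables. -/
def IsAffineLinear (Q : QuadFn) : Prop :=
  ∃ c : Fin 2 → Fin 2 → Fin 2 → Fin 2 → ℂ, ∀ u u1 u2 u12 : ℂ,
    Q u u1 u2 u12 = ∑ i : Fin 2, ∑ j : Fin 2, ∑ k : Fin 2, ∑ l : Fin 2,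
      c i j k l * u ^ (i : ℕ) * u1 ^ (j : ℕ) * u2 ^ (k : ℕ) * u12 ^ (l : ℕ)

/-- On the cube with spacing parameters `p, q, r` and initial values `u, u1, u2, u3`, the equations
on the three faces at `u` have unique solutions `u12, u13, u23`, and after that each of the three
remaining faces determines one and the same value `u123` at the last vertex. -/
def CubeValue {Λ : Type*} (Q : Λ → Λ → QuadFn) (p q r : Λ) (u u1 u2 u3 u123 : ℂ) : Prop :=
  ∃ u12 u13 u23 : ℂ,
    (∀ x, Q p q u u1 u2 x = 0 ↔ x = u12) ∧
    (∀ x, Q p r u u1 u3 x = 0 ↔ x = u13) ∧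
    (∀ x, Q q r u u2 u3 x = 0 ↔ x = u23) ∧
    (∀ x, Q p q u3 u13 u23 x = 0 ↔ x = u123) ∧
    (∀ x, Q p r u2 u12 u23 x = 0 ↔ x = u123) ∧
    (∀ x, Q q r u1 u12 u13 x = 0 ↔ x = u123)

/-- Consistency around the cube: for pairwise distinct parameters and generic initial values (off
the zero set of some nonzero polynomial in the initial values) the value at the last vertex is the
same no matter which face is used to calculate it. -/
def ConsistentAroundCube {Λ : Type*} (Q : Λ → Λ → QuadFn) : Prop :=
  ∀ p q r : Λ, p ≠ q → p ≠ r → q ≠ r →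
    ∃ D : MvPolynomial (Fin 4) ℂ, D ≠ 0 ∧ ∀ u u1 u2 u3 : ℂ,
      MvPolynomial.eval ![u, u1, u2, u3] D ≠ 0 → ∃ u123, CubeValue Q p q r u u1 u2 u3 u123

/-- Tetrahedron property: for generic initial values the value at the last vertex of the cube
depends on `u1, u2, u3` only, and not on `u`. -/
def TetrahedronProperty {Λ : Type*} (Q : Λ → Λ → QuadFn) : Prop :=
  ∀ p q r : Λ, p ≠ q → p ≠ r → q ≠ r →
    ∃ D : MvPolynomial (Fin 4) ℂ, D ≠ 0 ∧ ∀ u u' u1 u2 u3 v v' : ℂ,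
      MvPolynomial.eval ![u, u1, u2, u3] D ≠ 0 → MvPolynomial.eval ![u', u1, u2, u3] D ≠ 0 →
      CubeValue Q p q r u u1 u2 u3 v → CubeValue Q p q r u' u1 u2 u3 v' → v = v'

/-- A two-component system on the edges of the lattice, together with a quadrilateral equation for
each of the two components `u` and `U`. `edge p u ũ U Ũ` is the relation on an edge with
parameter `p`. -/
structure Triplet (Λ : Type*) where
  /-- The relation on the edges. -/
  edge : Λ → ℂ → ℂ → ℂ → ℂ → Prop
  /-- The `u`-equation. -/
  uEq : Λ → Λ → QuadFn
  /-- The `U`-equation. -/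
  UEq : Λ → Λ → QuadFn

/-- The triplet in which `u` and `U` have changed roles. -/
def Triplet.swap {Λ : Type*} (t : Triplet Λ) : Triplet Λ where
  edge p u u1 U U1 := t.edge p U U1 u u1
  uEq := t.UEq
  UEq := t.uEq

/-- The triplet with the system `h(u, ũ, p) = U Ũ`, `h(u, û, q) = U Û`, the `u`-equation `Q` and the
`U`-equation `F`. -/
def Triplet.ofH {Λ : Type*} (h : Λ → ℂ → ℂ → ℂ) (Q F : Λ → Λ → QuadFn) : Triplet Λ where
  edge p u u1 U U1 := h p u u1 = U * U1
  uEq := Q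
  UEq := F

/-- The compatibility of the edge system with respect to its first component `u` yields the equation
`E` for its second component `U`: given the four values of `U`, and values `u, ũ, û` that satisfy
the two equations at the vertex of `u`, the other two equations give one common value `ũ̂` if and
only if `E = 0`. The given values of `u` are nonzero, as solving the equations may involve a
division by them. -/
def CompatYields {Λ : Type*} (edge : Λ → ℂ → ℂ → ℂ → ℂ → Prop) (E : Λ → Λ → QuadFn) : Prop :=
  ∀ p q : Λ, p ≠ q → ∀ u u1 u2 U U1 U2 U12 : ℂ, u ≠ 0 → u1 ≠ 0 → u2 ≠ 0 →
    edge p u u1 U U1 → edge q u u2 U U2 →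
    ((∃ u12, edge p u2 u12 U2 U12 ∧ edge q u1 u12 U1 U12) ↔ E p q U U1 U2 U12 = 0)

/-- The triplet is consistent: the compatibility of the system with respect to `u` yields the
`U`-equation, and its compatibility with respect to `U` yields the `u`-equation. -/
def Triplet.IsConsistent {Λ : Type*} (t : Triplet Λ) : Prop :=
  CompatYields t.edge t.UEq ∧ CompatYields t.swap.edge t.swap.UEq

/-- `h(u, ũ, p) = s₀(p) + s₁(p) u + s₂(p) ũ`, where `s₁` and `s₂` do not vanish. -/
def IsLinearForm {Λ : Type*} (h : Λ → ℂ → ℂ → ℂ) : Prop :=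
  ∃ s0 s1 s2 : Λ → ℂ, (∀ p, s1 p ≠ 0) ∧ (∀ p, s2 p ≠ 0) ∧
    ∀ p u u1, h p u u1 = s0 p + s1 p * u + s2 p * u1

/-- `h(u, ũ, p) = s₀(p) + s₃(p) u ũ`, where `s₀` and `s₃` do not vanish. -/
def IsBilinearForm {Λ : Type*} (h : Λ → ℂ → ℂ → ℂ) : Prop :=
  ∃ s0 s3 : Λ → ℂ, (∀ p, s0 p ≠ 0) ∧ (∀ p, s3 p ≠ 0) ∧
    ∀ p u u1, h p u u1 = s0 p + s3 p * u * u1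

/-- `t` is turned into `t'` by a change of the fields `u = a v + b`, `U = c V`, where `a, b, c` may
depend on the site of the lattice with one direction for each parameter. -/
def Triplet.GaugeEquiv {Λ : Type*} (t t' : Triplet Λ) : Prop :=
  ∃ a b c : (Λ →₀ ℤ) → ℂ, (∀ x, a x ≠ 0) ∧ (∀ x, c x ≠ 0) ∧
    (∀ x p u u1 U U1,
      t.edge p (a x * u + b x)
          (a (x + Finsupp.single p 1) * u1 + b (x + Finsupp.single p 1))
          (c x * U) (c (x + Finsupp.single p 1) * U1) ↔
        t'.edge p u u1 U U1) ∧
    (∀ x p q, p ≠ q → ∃ κ : ℂ, κ ≠ 0 ∧ ∀ u u1 u2 u12,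
      t.uEq p q (a x * u + b x)
          (a (x + Finsupp.single p 1) * u1 + b (x + Finsupp.single p 1))
          (a (x + Finsupp.single q 1) * u2 + b (x + Finsupp.single q 1))
          (a (x + Finsupp.single p 1 + Finsupp.single q 1) * u12
            + b (x + Finsupp.single p 1 + Finsupp.single q 1)) =
        κ * t'.uEq p q u u1 u2 u12) ∧
    (∀ x p q, p ≠ q → ∃ κ : ℂ, κ ≠ 0 ∧ ∀ U U1 U2 U12,
      t.UEq p q (c x * U) (c (x + Finsupp.single p 1) * U1) (c (x + Finsupp.single q 1) * U2)
          (c (x + Finsupp.single p 1 + Finsupp.single q 1) * U12) =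
        κ * t'.UEq p q U U1 U2 U12)

/-- H1. -/
def eqH1 (p q : ℂ) : QuadFn := fun u u1 u2 u12 => (u - u12) * (u1 - u2) - p + q

/-- H2. -/
def eqH2 (p q : ℂ) : QuadFn := fun u u1 u2 u12 =>
  (u - u12) * (u1 - u2) - (p - q) * (u + u1 + u2 + u12 + p + q)

/-- H3(δ). -/
def eqH3 (δ p q : ℂ) : QuadFn := fun u u1 u2 u12 =>
  p * (u * u1 + u2 * u12) - q * (u * u2 + u1 * u12) + δ * (p ^ 2 - q ^ 2)

/-- A1(δ). -/
def eqA1 (δ p q : ℂ) : QuadFn := fun u u1 u2 u12 =>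
  p * (u + u2) * (u1 + u12) - q * (u + u1) * (u2 + u12) - δ ^ 2 * p * q * (p - q)

/-- A2. -/
def eqA2 (p q : ℂ) : QuadFn := fun u u1 u2 u12 =>
  p * (1 - q ^ 2) * (u * u1 + u2 * u12) - q * (1 - p ^ 2) * (u * u2 + u1 * u12)
    - (p ^ 2 - q ^ 2) * (1 + u * u1 * u2 * u12)

/-- Q1(δ). -/
def eqQ1 (δ p q : ℂ) : QuadFn := fun u u1 u2 u12 =>
  p * (u - u2) * (u1 - u12) - q * (u - u1) * (u2 - u12) + δ ^ 2 * p * q * (p - q)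

/-- The lattice potential modified KdV equation. -/
def eqLpmKdV (p q : ℂ) : QuadFn := fun u u1 u2 u12 =>
  p * (u * u1 - u2 * u12) - q * (u * u2 - u1 * u12)

/-- The equation `q² (u ũ - 1) (û ũ̂ - 1) = p² (u û - 1) (ũ ũ̂ - 1)`. -/
def eqNew (p q : ℂ) : QuadFn := fun u u1 u2 u12 =>
  q ^ 2 * (u * u1 - 1) * (u2 * u12 - 1) - p ^ 2 * (u * u2 - 1) * (u1 * u12 - 1)

/-- H3(1) in the variables `1 / U`, with denominators cleared. -/
def eqH3Inv (p q : ℂ) : QuadFn := fun U U1 U2 U12 =>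
  p * (U * U1 + U2 * U12) - q * (U * U2 + U1 * U12) + (p ^ 2 - q ^ 2) * (U * U1 * U2 * U12)

theorem eqH3Inv_eq (p q U U1 U2 U12 : ℂ) (h : U ≠ 0) (h1 : U1 ≠ 0) (h2 : U2 ≠ 0)
    (h12 : U12 ≠ 0) :
    eqH3Inv p q U U1 U2 U12 =
      U * U1 * U2 * U12 * eqH3 1 p q U⁻¹ U1⁻¹ U2⁻¹ U12⁻¹ := by
  simp only [eqH3Inv, eqH3]
  field_simp
  ring

/-- The six systems `h(u, ũ, p) = U Ũ` of the list, with `h`, `u`-equation and `U`-equation;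
`π p` is the value of the lattice parameter. -/
inductive TableRow {Λ : Type*} (π : Λ → ℂ) :
    (Λ → ℂ → ℂ → ℂ) → (Λ → Λ → QuadFn) → (Λ → Λ → QuadFn) → Prop
  | no1 (hπ : ∀ p, π p ≠ 0) :
      TableRow π (fun p u u1 => 1 / π p * (u - u1))
        (fun p q => eqQ1 0 (π p ^ 2) (π q ^ 2))
        (fun p q => eqLpmKdV (π p) (π q))
  | no2 :
      TableRow π (fun p u u1 => u + u1 + π p)
        (fun p q => eqH2 (π p) (π q))
        (fun p q => eqH1 (2 * π p) (2 * π q))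
  | no3 (δ : ℂ) (hπ : ∀ p, π p ≠ 0) :
      TableRow π (fun p u u1 => 1 / π p * (u + u1 - δ * π p ^ 2))
        (fun p q => eqA1 δ (π p ^ 2) (π q ^ 2))
        (fun p q => eqH3 δ (2 * π p) (2 * π q))
  | no4 (δ : ℂ) (hδ : δ ≠ 0) (hπ : ∀ p, π p ≠ 0) :
      TableRow π (fun p u u1 => u * u1 + δ * π p)
        (fun p q => eqH3 δ (π p) (π q))
        (fun p q => eqH3 (-δ) (π p) (π q))
  | no5 (hπ : ∀ p, π p ≠ 0) :
      TableRow π (fun p u u1 => 1 / π p * (u * u1 - 1))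
        (fun p q => eqNew (π p) (π q))
        (fun p q => eqH3Inv (π p) (π q))
  | no6 (σ : Λ → ℂ) (hπ : ∀ p, π p ≠ 0) (hσ : ∀ p, σ p ≠ 0)
      (hσπ : ∀ p, σ p ^ 2 = 1 - π p ^ 2) :
      TableRow π (fun p u u1 => 1 / σ p * (1 - π p * u * u1))
        (fun p q => eqA2 (π p) (π q))
        (fun p q => eqA2 (σ p) (σ q))

/-! Both `h(u,ũ,p) h(û,ũ̂,p)` and `h(u,û,q) h(ũ,ũ̂,q)` equal `U Ũ Û Ũ̂`, so compatibility in `U` is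
the vanishing of `productEq`. If `h` is linear, a combination of the four edge relations eliminates
`u` and leaves `linearEq`. If `h` is bilinear, the edge relation can be solved for `u ũ`, and
compatibility in `u` is again a `productEq`, that of the dual function `bilinearDual`. A polynomial
of degree at most one in each variable with the same zeros, even if only off the zero set of the
divisors, is a nonzero multiple (`exists_proportional_productEq`, `isNonzeroMultiple_linearEq`).
Hence `h` determines `Q` and `F` up to factors, and the theorem becomes a question about the
coefficients `s_i`.

Part (a). The listed polynomials are multiples of those computed from `h`. For each of them,
substitution into the face at `u3` of the cube gives `K (M x + N)`, where `K` involves only the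
fields `u, u3` and `M, N` only `u1, u2, u3`; moreover `M` and `N` are alternating under permutation
of the three directions. By symmetry all three faces give `-N / M`, which proves consistency and the
tetrahedron property together (`consistentAroundCube_of_factorization`).

Part (b). Equality of the values from two faces is, after clearing denominators, a polynomial
identity in the initial values; suitable points turn it into equations for the `s_i`. In the linear
case (`linear_classification`) either the constant terms of all `linearEq` vanish (entry 1), or `s₁
= s₂` and `s₁²` is constant (entry 2) or `s₀ = k s₁ + μ / s₁` (entry 3). In the bilinear case
(`bilinear_cube_condition`) the points `(s₀², s₃²)` lie on a line `α s₀² + β s₃² = γ`: `α = 0` gives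
entry 4, `β = 0` entry 5 with `u` and `U` interchanged, `γ = 0` entry 5, and the remaining lines
entry 6. The remaining signs and factors are absorbed into site-dependent factors such as
`siteProd`. -/

/-! ### Polynomial functions and generic points -/

/-- A function of four complex variables that is given by a polynomial. -/
@[fun_prop]
def IsPolynomialFun (f : (Fin 4 → ℂ) → ℂ) : Prop :=
  ∃ D : MvPolynomial (Fin 4) ℂ, ∀ x, f x = MvPolynomial.eval x D

namespace IsPolynomialFun

variable {f g : (Fin 4 → ℂ) → ℂ}

@[fun_prop]
theorem const (c : ℂ) : IsPolynomialFun (fun _ => c) := ⟨MvPolynomial.C c, fun x => by simp⟩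

@[fun_prop]
theorem coord (i : Fin 4) : IsPolynomialFun (fun x => x i) := ⟨MvPolynomial.X i, fun x => by simp⟩

@[fun_prop]
theorem add (hf : IsPolynomialFun f) (hg : IsPolynomialFun g) :
    IsPolynomialFun (fun x => f x + g x) := by
  obtain ⟨D, hD⟩ := hf
  obtain ⟨E, hE⟩ := hg
  exact ⟨D + E, fun x => by simp [hD, hE]⟩

@[fun_prop]
theorem sub (hf : IsPolynomialFun f) (hg : IsPolynomialFun g) :
    IsPolynomialFun (fun x => f x - g x) := by
  obtain ⟨D, hD⟩ := hf
  obtain ⟨E, hE⟩ := hg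
  exact ⟨D - E, fun x => by simp [hD, hE]⟩

@[fun_prop]
theorem neg (hf : IsPolynomialFun f) : IsPolynomialFun (fun x => -f x) := by
  obtain ⟨D, hD⟩ := hf
  exact ⟨-D, fun x => by simp [hD]⟩

@[fun_prop]
theorem mul (hf : IsPolynomialFun f) (hg : IsPolynomialFun g) :
    IsPolynomialFun (fun x => f x * g x) := by
  obtain ⟨D, hD⟩ := hf
  obtain ⟨E, hE⟩ := hg
  exact ⟨D * E, fun x => by simp [hD, hE]⟩

@[fun_prop]
theorem pow (hf : IsPolynomialFun f) (n : ℕ) : IsPolynomialFun (fun x => f x ^ n) := by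
  obtain ⟨D, hD⟩ := hf
  exact ⟨D ^ n, fun x => by simp [hD]⟩

end IsPolynomialFun

/-- A property of four complex numbers that holds off the zero set of a nonzero polynomial. -/
def Generically (P : (Fin 4 → ℂ) → Prop) : Prop :=
  ∃ D : MvPolynomial (Fin 4) ℂ, D ≠ 0 ∧ ∀ x, MvPolynomial.eval x D ≠ 0 → P x

namespace Generically

variable {P R : (Fin 4 → ℂ) → Prop} {f : (Fin 4 → ℂ) → ℂ}

theorem mono (hP : Generically P) (h : ∀ x, P x → R x) : Generically R := by
  obtain ⟨D, hD, h'⟩ := hP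
  exact ⟨D, hD, fun x hx => h x (h' x hx)⟩

theorem and (hP : Generically P) (hR : Generically R) : Generically (fun x => P x ∧ R x) := by
  obtain ⟨D, hD, h⟩ := hP
  obtain ⟨E, hE, h'⟩ := hR
  refine ⟨D * E, mul_ne_zero hD hE, fun x hx => ?_⟩
  rw [map_mul] at hx
  exact ⟨h x (left_ne_zero_of_mul hx), h' x (right_ne_zero_of_mul hx)⟩

theorem ne_zero (hf : IsPolynomialFun f) (h : ∃ x, f x ≠ 0) : Generically (fun x => f x ≠ 0) := by
  obtain ⟨D, hD⟩ := hf
  obtain ⟨x, hx⟩ := h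
  refine ⟨D, ?_, fun y hy => (hD y).trans_ne hy⟩
  rintro rfl
  simp [hD] at hx

theorem exists_of (hP : Generically P) : ∃ x, P x := by
  obtain ⟨D, hD, h⟩ := hP
  by_contra! hx
  refine hD (MvPolynomial.funext fun x => ?_)
  by_contra h0
  exact hx x (h x (by simpa using h0))

/-- A polynomial identity proved at generic points holds everywhere. It may then be evaluated at
degenerate points, where the cube itself need not be solvable. -/
theorem eq_zero (hf : IsPolynomialFun f) (h : Generically (fun x => f x = 0)) (x : Fin 4 → ℂ) :
    f x = 0 := by
  by_contra hx
  obtain ⟨y, h1, h2⟩ := (h.and (ne_zero hf ⟨x, hx⟩)).exists_of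
  exact h2 h1

end Generically

theorem generically_iff (P : ℂ → ℂ → ℂ → ℂ → Prop) : (∃ D : MvPolynomial (Fin 4) ℂ, D ≠ 0 ∧ ∀ u u1 u2 u3 : ℂ,
      MvPolynomial.eval ![u, u1, u2, u3] D ≠ 0 → P u u1 u2 u3) ↔ Generically (fun x => P (x 0) (x 1) (x 2) (x 3)) := by
  constructor
  · rintro ⟨D, hD, h⟩
    refine ⟨D, hD, fun x hx => h _ _ _ _ ?_⟩
    rwa [show ![x 0, x 1, x 2, x 3] = x from by ext i; fin_cases i <;> rfl]
  · rintro ⟨D, hD, h⟩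
    exact ⟨D, hD, fun u u1 u2 u3 hx => h _ hx⟩

/-! ### Multi-affine polynomials with the same zeros -/

/-- A function of four variables that is affine in each of them is a polynomial of degree at most
one in each of them. -/
theorem isAffineLinear_of_affine {Q : QuadFn}
    (h0 : ∀ u u1 u2 u12, Q u u1 u2 u12 = Q 0 u1 u2 u12 + u * (Q 1 u1 u2 u12 - Q 0 u1 u2 u12))
    (h1 : ∀ u u1 u2 u12, Q u u1 u2 u12 = Q u 0 u2 u12 + u1 * (Q u 1 u2 u12 - Q u 0 u2 u12))
    (h2 : ∀ u u1 u2 u12, Q u u1 u2 u12 = Q u u1 0 u12 + u2 * (Q u u1 1 u12 - Q u u1 0 u12))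
    (h3 : ∀ u u1 u2 u12, Q u u1 u2 u12 = Q u u1 u2 0 + u12 * (Q u u1 u2 1 - Q u u1 u2 0)) :
    IsAffineLinear Q := by
  -- The matrix turns the values at the nodes 0 and 1 into the constant term and the slope, once for
  -- each variable.
  refine ⟨fun i j k l => ∑ a : Fin 2, ∑ b : Fin 2, ∑ c : Fin 2, ∑ d : Fin 2,
    !![1, 0; -1, 1] i a * !![1, 0; -1, 1] j b * !![1, 0; -1, 1] k c * !![1, 0; -1, 1] l d *
      Q (a : ℕ) (b : ℕ) (c : ℕ) (d : ℕ), fun u u1 u2 u12 => ?_⟩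
  simp only [Fin.sum_univ_two]
  norm_num
  rw [h0 u, h1 0 u1, h1 1 u1, h2 0 0 u2, h2 0 1 u2, h2 1 0 u2, h2 1 1 u2,
    h3 0 0 0 u12, h3 0 0 1 u12, h3 0 1 0 u12, h3 0 1 1 u12, h3 1 0 0 u12, h3 1 0 1 u12,
    h3 1 1 0 u12, h3 1 1 1 u12]
  ring

theorem IsAffineLinear.isPolynomialFun {Q : QuadFn} (hQ : IsAffineLinear Q) :
    IsPolynomialFun (fun x => Q (x 0) (x 1) (x 2) (x 3)) := by
  obtain ⟨c, hc⟩ := hQ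
  simp only [hc, Fin.sum_univ_two]
  fun_prop

theorem IsAffineLinear.affine {Q : QuadFn} (hQ : IsAffineLinear Q) :
    (∀ u u1 u2 u12, Q u u1 u2 u12 = Q 0 u1 u2 u12 + u * (Q 1 u1 u2 u12 - Q 0 u1 u2 u12)) ∧
    (∀ u u1 u2 u12, Q u u1 u2 u12 = Q u 0 u2 u12 + u1 * (Q u 1 u2 u12 - Q u 0 u2 u12)) ∧
    (∀ u u1 u2 u12, Q u u1 u2 u12 = Q u u1 0 u12 + u2 * (Q u u1 1 u12 - Q u u1 0 u12)) ∧
    (∀ u u1 u2 u12, Q u u1 u2 u12 = Q u u1 u2 0 + u12 * (Q u u1 u2 1 - Q u u1 u2 0)) := by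
  obtain ⟨c, hc⟩ := hQ
  refine ⟨?_, ?_, ?_, ?_⟩ <;> intro u u1 u2 u12 <;> simp only [hc, Fin.sum_univ_two] <;> norm_num <;> ring

/-- The multi-affine expression `f(u, ũ) f(û, ũ̂) - g(u, û) g(ũ, ũ̂)`. -/
def productEq (f g : ℂ → ℂ → ℂ) : QuadFn := fun u u1 u2 u12 =>
  f u u1 * f u2 u12 - g u u2 * g u1 u12

/-- Proportionality along all lines parallel to a coordinate axis implies proportionality. -/
theorem exists_proportional_of_lines {E H : QuadFn}
    (hE : IsPolynomialFun fun x => E (x 0) (x 1) (x 2) (x 3))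
    (hH : IsPolynomialFun fun x => H (x 0) (x 1) (x 2) (x 3))
    (hH0 : ∃ u u1 u2 u12, H u u1 u2 u12 ≠ 0)
    (h0 : ∀ s t u1 u2 u12, E s u1 u2 u12 * H t u1 u2 u12 = E t u1 u2 u12 * H s u1 u2 u12)
    (h1 : ∀ u s t u2 u12, E u s u2 u12 * H u t u2 u12 = E u t u2 u12 * H u s u2 u12)
    (h2 : ∀ u u1 s t u12, E u u1 s u12 * H u u1 t u12 = E u u1 t u12 * H u u1 s u12)
    (h3 : ∀ u u1 u2 s t, E u u1 u2 s * H u u1 u2 t = E u u1 u2 t * H u u1 u2 s) :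
    ∃ κ, ∀ u u1 u2 u12, E u u1 u2 u12 = κ * H u u1 u2 u12 := by
  obtain ⟨y0, y1, y2, y3, hy⟩ := hH0
  -- The ratio `κ` is carried from a point with `H ≠ 0` to the next point on a line.
  have step : ∀ {κ a b c d : ℂ}, b ≠ 0 → a = κ * b → a * d = c * b → c = κ * d := by
    intro κ a b c d hb hab h
    apply mul_right_cancel₀ hb
    rw [← h, hab]
    ring
  refine ⟨E y0 y1 y2 y3 / H y0 y1 y2 y3, fun u u1 u2 u12 => ?_⟩
  set κ := E y0 y1 y2 y3 / H y0 y1 y2 y3 with hκ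
  have hκy : E y0 y1 y2 y3 = κ * H y0 y1 y2 y3 := by rw [hκ]; field_simp
  obtain ⟨D, hD⟩ := hH
  -- Freezing some coordinates of `H` at those of `y` again gives a polynomial function.
  have hsub : ∀ g : Fin 4 → MvPolynomial (Fin 4) ℂ, IsPolynomialFun (fun x =>
      H (MvPolynomial.eval x (g 0)) (MvPolynomial.eval x (g 1)) (MvPolynomial.eval x (g 2))
        (MvPolynomial.eval x (g 3))) := fun g =>
    ⟨MvPolynomial.bind₁ g D, fun x => (hD fun i => MvPolynomial.eval x (g i)).trans
      (MvPolynomial.eval₂Hom_bind₁ _ _ _ _).symm⟩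
  have hp1 : IsPolynomialFun (fun x => H (x 0) y1 y2 y3) := by
    simpa using hsub ![.X 0, .C y1, .C y2, .C y3]
  have hp2 : IsPolynomialFun (fun x => H (x 0) (x 1) y2 y3) := by
    simpa using hsub ![.X 0, .X 1, .C y2, .C y3]
  have hp3 : IsPolynomialFun (fun x => H (x 0) (x 1) (x 2) y3) := by
    simpa using hsub ![.X 0, .X 1, .X 2, .C y3]
  -- The path from `y` to `x` replaces one coordinate at a time; `H` must not vanish at the three
  -- intermediate points.
  have hgen := ((Generically.ne_zero hp1 ⟨![y0, y1, y2, y3], hy⟩).and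
    (Generically.ne_zero hp2 ⟨![y0, y1, y2, y3], hy⟩)).and
    (Generically.ne_zero hp3 ⟨![y0, y1, y2, y3], hy⟩)
  have hzero : Generically (fun x => E (x 0) (x 1) (x 2) (x 3)
      - κ * H (x 0) (x 1) (x 2) (x 3) = 0) := by
    refine hgen.mono fun x hx => sub_eq_zero.2 ?_
    obtain ⟨⟨a1, a2⟩, a3⟩ := hx
    exact step a3 (step a2 (step a1 (step hy hκy (h0 _ _ _ _ _)) (h1 _ _ _ _ _))
      (h2 _ _ _ _ _)) (h3 _ _ _ _ _)
  have := hzero.eq_zero (hE.sub ((IsPolynomialFun.const κ).mul ⟨D, hD⟩)) ![u, u1, u2, u12]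
  exact sub_eq_zero.1 this

/-- Two affine functions of one variable are proportional if the root of the second is a root of the
first. -/
theorem affine_cross_eq_zero {e h : ℂ → ℂ} (he : ∀ t, e t = e 0 + t * (e 1 - e 0))
    (hh : ∀ t, h t = h 0 + t * (h 1 - h 0)) (h1 : h 1 - h 0 ≠ 0) (hz : ∀ t, h t = 0 → e t = 0) :
    e 0 * h 1 - e 1 * h 0 = 0 := by
  have h2 := hz (-h 0 / (h 1 - h 0)) (by rw [hh]; field_simp; ring)
  rw [he] at h2
  field_simp at h2
  linear_combination h2

/-- The determinant of the values of two affine functions at `s` and `t` is `t - s` times the one at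
0 and 1. -/
theorem affine_cross_eq {e h : ℂ → ℂ} (he : ∀ t, e t = e 0 + t * (e 1 - e 0))
    (hh : ∀ t, h t = h 0 + t * (h 1 - h 0)) (h0 : e 0 * h 1 - e 1 * h 0 = 0) (s t : ℂ) :
    e s * h t = e t * h s := by
  rw [he s, he t, hh s, hh t]
  linear_combination (t - s) * h0

theorem isAffineLinear_productEq (a0 a1 a2 a3 b0 b1 b2 b3 : ℂ) :
    IsAffineLinear (productEq (fun u v => a0 + a1 * u + a2 * v + a3 * u * v)
      (fun u v => b0 + b1 * u + b2 * v + b3 * u * v)) := by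
  apply isAffineLinear_of_affine <;> intro u u1 u2 u12 <;> simp only [productEq] <;> ring

/-- A multi-affine polynomial which, off the zero set of `f(u, ũ) g(u, û)`, has the same zeros as
`f(u, ũ) f(û, ũ̂) - g(u, û) g(ũ, ũ̂)` is a multiple of it. -/
theorem exists_proportional_productEq {a0 a1 a2 a3 b0 b1 b2 b3 : ℂ}
    (hc : (a3 = 0 ∧ b3 = 0 ∧ a1 ≠ 0 ∧ a2 ≠ 0 ∧ b1 ≠ 0 ∧ b2 ≠ 0) ∨
      (a1 = 0 ∧ a2 = 0 ∧ b1 = 0 ∧ b2 = 0 ∧ a0 ≠ 0 ∧ a3 ≠ 0 ∧ b0 ≠ 0 ∧ b3 ≠ 0))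
    {f g : ℂ → ℂ → ℂ} (hf : ∀ u v, f u v = a0 + a1 * u + a2 * v + a3 * u * v)
    (hg : ∀ u v, g u v = b0 + b1 * u + b2 * v + b3 * u * v)
    {E : QuadFn} (hE : IsAffineLinear E)
    (hz : ∀ u u1 u2 u12, f u u1 ≠ 0 → g u u2 ≠ 0 →
      (productEq f g u u1 u2 u12 = 0 ↔ E u u1 u2 u12 = 0)) :
    ∃ κ, κ ≠ 0 ∧ ∀ u u1 u2 u12, E u u1 u2 u12 = κ * productEq f g u u1 u2 u12 := by
  have hfg : IsAffineLinear (productEq f g) := by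
    have := isAffineLinear_productEq a0 a1 a2 a3 b0 b1 b2 b3
    rwa [show f = _ from funext₂ hf, show g = _ from funext₂ hg]
  obtain ⟨e0, e1, e2, e3⟩ := hE.affine
  obtain ⟨k0, k1, k2, k3⟩ := hfg.affine
  have hEp := hE.isPolynomialFun
  -- polynomials that do not vanish identically
  have f01 : Generically fun x => f (x 0) (x 1) ≠ 0 := by
    refine .ne_zero (by simp only [hf]; fun_prop) ?_
    rcases hc with ⟨h3, -, h1, -⟩ | ⟨h1, h2, -, -, h0, -⟩
    · exact ⟨![(1 - a0) / a1, 0, 0, 0], by simp [hf, h3]; field_simp; simp⟩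
    · exact ⟨![0, 0, 0, 0], by simp [hf, h0]⟩
  have f23 : Generically fun x => f (x 2) (x 3) ≠ 0 := by
    refine .ne_zero (by simp only [hf]; fun_prop) ?_
    rcases hc with ⟨h3, -, h1, -⟩ | ⟨h1, h2, -, -, h0, -⟩
    · exact ⟨![0, 0, (1 - a0) / a1, 0], by simp [hf, h3]; field_simp; simp⟩
    · exact ⟨![0, 0, 0, 0], by simp [hf, h0]⟩
  have g02 : Generically fun x => g (x 0) (x 2) ≠ 0 := by
    refine .ne_zero (by simp only [hg]; fun_prop) ?_
    rcases hc with ⟨-, h3, -, -, h1, -⟩ | ⟨-, -, -, -, -, -, h0, -⟩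
    · exact ⟨![(1 - b0) / b1, 0, 0, 0], by simp [hg, h3]; field_simp; simp⟩
    · exact ⟨![0, 0, 0, 0], by simp [hg, h0]⟩
  have g13 : Generically fun x => g (x 1) (x 3) ≠ 0 := by
    refine .ne_zero (by simp only [hg]; fun_prop) ?_
    rcases hc with ⟨-, h3, -, -, h1, -⟩ | ⟨-, -, -, -, -, -, h0, -⟩
    · exact ⟨![0, (1 - b0) / b1, 0, 0], by simp [hg, h3]; field_simp; simp⟩
    · exact ⟨![0, 0, 0, 0], by simp [hg, h0]⟩
  -- `d0` to `d3`: the slope of `productEq` in each variable is not identically zero. The fractions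
  -- in the witnesses solve the equation slope `= 1` in the linear case.
  have d0 : Generically fun x => productEq f g 1 (x 1) (x 2) (x 3)
      - productEq f g 0 (x 1) (x 2) (x 3) ≠ 0 := by
    refine .ne_zero (by simp only [productEq, hf, hg]; fun_prop) ?_
    rcases hc with ⟨h3, h3', h1, h2, h1', h2'⟩ | ⟨h1, h2, h1', h2', h0, h3, h0', h3'⟩
    · refine ⟨![0, 0, (1 + b1 * b0 - a1 * a0) / a1 ^ 2, 0], ?_⟩
      simp [productEq, hf, hg, h3, h3']; field_simp; ring_nf; simpa using h1
    · refine ⟨![0, 1, 0, 0], ?_⟩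
      simp [productEq, hf, hg, h1, h2, h1', h2']; ring_nf; simp [h0, h3]
  have d1 : Generically fun x => productEq f g (x 0) 1 (x 2) (x 3)
      - productEq f g (x 0) 0 (x 2) (x 3) ≠ 0 := by
    refine .ne_zero (by simp only [productEq, hf, hg]; fun_prop) ?_
    rcases hc with ⟨h3, h3', h1, h2, h1', h2'⟩ | ⟨h1, h2, h1', h2', h0, h3, h0', h3'⟩
    · refine ⟨![0, 0, 0, (1 + b1 * b0 - a2 * a0) / a2 ^ 2], ?_⟩
      simp [productEq, hf, hg, h3, h3']; field_simp; ring_nf; simpa using h2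
    · refine ⟨![1, 0, 0, 0], ?_⟩
      simp [productEq, hf, hg, h1, h2, h1', h2']; ring_nf; simp [h0, h3]
  have d2 : Generically fun x => productEq f g (x 0) (x 1) 1 (x 3)
      - productEq f g (x 0) (x 1) 0 (x 3) ≠ 0 := by
    refine .ne_zero (by simp only [productEq, hf, hg]; fun_prop) ?_
    rcases hc with ⟨h3, h3', h1, h2, h1', h2'⟩ | ⟨h1, h2, h1', h2', h0, h3, h0', h3'⟩
    · refine ⟨![0, 0, 0, (-1 - b2 * b0 + a1 * a0) / b2 ^ 2], ?_⟩
      simp [productEq, hf, hg, h3, h3']; field_simp; ring_nf; simpa using h2'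
    · refine ⟨![0, 0, 0, 1], ?_⟩
      simp [productEq, hf, hg, h1, h2, h1', h2']; ring_nf; simp [h0, h3]
  have d3 : Generically fun x => productEq f g (x 0) (x 1) (x 2) 1
      - productEq f g (x 0) (x 1) (x 2) 0 ≠ 0 := by
    refine .ne_zero (by simp only [productEq, hf, hg]; fun_prop) ?_
    rcases hc with ⟨h3, h3', h1, h2, h1', h2'⟩ | ⟨h1, h2, h1', h2', h0, h3, h0', h3'⟩
    · refine ⟨![0, (1 + b2 * b0 - a2 * a0) / a2 ^ 2, 0, 0], ?_⟩
      simp [productEq, hf, hg, h3, h3']; field_simp; ring_nf; simpa using h2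
    · refine ⟨![0, 0, 1, 0], ?_⟩
      simp [productEq, hf, hg, h1, h2, h1', h2']; ring_nf; simp [h0, h3]
  -- `r0`, `r1`, `r2` are resultants in the moving variable `t`, of `f(t, ũ)` and `g(t, û)`, of
  -- `f(u, t)` and `g(t, ũ̂)`, and of `g(u, t)` and `f(t, ũ̂)`. Where they are nonzero, a root of
  -- `productEq` cannot lie on the excluded set: if one divisor vanished there, the equation would
  -- force the other function of the pair to vanish as well.
  have r0 : Generically fun x => (a0 + a2 * x 1) * (b1 + b3 * x 2)
      - (b0 + b2 * x 2) * (a1 + a3 * x 1) ≠ 0 := by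
    refine .ne_zero (by fun_prop) ?_
    rcases hc with ⟨h3, h3', h1, h2, h1', h2'⟩ | ⟨h1, h2, h1', h2', h0, h3, h0', h3'⟩
    · refine ⟨![0, (1 + b0 * a1 - a0 * b1) / (a2 * b1), 0, 0], ?_⟩
      simp [h3, h3']; field_simp; ring_nf; simp
    · refine ⟨![0, 0, 1, 0], ?_⟩
      simp [h1, h1', h0, h3']
  have r1 : Generically fun x => (a0 + a1 * x 0) * (b1 + b3 * x 3)
      - (b0 + b2 * x 3) * (a2 + a3 * x 0) ≠ 0 := by
    refine .ne_zero (by fun_prop) ?_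
    rcases hc with ⟨h3, h3', h1, h2, h1', h2'⟩ | ⟨h1, h2, h1', h2', h0, h3, h0', h3'⟩
    · refine ⟨![(1 + b0 * a2 - a0 * b1) / (a1 * b1), 0, 0, 0], ?_⟩
      simp [h3, h3']; field_simp; ring_nf; simp
    · refine ⟨![0, 0, 0, 1], ?_⟩
      simp [h1', h2, h0, h3']
  have r2 : Generically fun x => (b0 + b1 * x 0) * (a1 + a3 * x 3)
      - (a0 + a2 * x 3) * (b2 + b3 * x 0) ≠ 0 := by
    refine .ne_zero (by fun_prop) ?_
    rcases hc with ⟨h3, h3', h1, h2, h1', h2'⟩ | ⟨h1, h2, h1', h2', h0, h3, h0', h3'⟩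
    · refine ⟨![(1 + a0 * b2 - b0 * a1) / (a1 * b1), 0, 0, 0], ?_⟩
      simp [h3, h3']; field_simp; ring_nf; simp
    · refine ⟨![0, 0, 0, 1], ?_⟩
      simp [h1, h2', h0', h3]
  obtain ⟨κ, hκ⟩ : ∃ κ, ∀ u u1 u2 u12, E u u1 u2 u12 = κ * productEq f g u u1 u2 u12 := by
    obtain ⟨c, hcE⟩ := id hE
    refine exists_proportional_of_lines hEp hfg.isPolynomialFun ?_ ?_ ?_ ?_ ?_
    · obtain ⟨x, hx⟩ := d0.exists_of
      by_contra! h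
      exact hx (by rw [h, h, sub_zero])
    · intro s t u1 u2 u12
      refine affine_cross_eq (e := fun s => E s u1 u2 u12)
        (h := fun s => productEq f g s u1 u2 u12) (fun _ => e0 _ _ _ _) (fun _ => k0 _ _ _ _) ?_ s t
      refine Generically.eq_zero (f := fun x => E 0 (x 1) (x 2) (x 3) * productEq f g 1 (x 1) (x 2)
        (x 3) - E 1 (x 1) (x 2) (x 3) * productEq f g 0 (x 1) (x 2) (x 3)) ?_ ?_ ![0, u1, u2, u12]
      · simp only [hcE, productEq, hf, hg, Fin.sum_univ_two]
        fun_prop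
      · refine (((d0.and r0).and f23).and g13).mono fun x hx => ?_
        obtain ⟨⟨⟨hd, hr⟩, hf23⟩, hg13⟩ := hx
        refine affine_cross_eq_zero (e := fun s => E s _ _ _)
          (h := fun s => productEq f g s _ _ _) (fun _ => e0 _ _ _ _) (fun _ => k0 _ _ _ _) hd ?_
        intro t ht
        have hne : ¬(f t (x 1) = 0 ∧ g t (x 2) = 0) := by
          rintro ⟨h, h'⟩
          rw [hf] at h
          rw [hg] at h'
          apply hr
          linear_combination (b1 + b3 * x 2) * h - (a1 + a3 * x 1) * h'
        simp only [productEq] at ht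
        refine (hz _ _ _ _ (fun h => hne ⟨h, ?_⟩) (fun h => hne ⟨?_, h⟩)).1 ht
        · rw [h] at ht
          simpa [hg13] using ht
        · rw [h] at ht
          simpa [hf23] using ht
    · intro u s t u2 u12
      refine affine_cross_eq (e := fun s => E u s u2 u12)
        (h := fun s => productEq f g u s u2 u12) (fun _ => e1 _ _ _ _) (fun _ => k1 _ _ _ _) ?_ s t
      refine Generically.eq_zero (f := fun x => E (x 0) 0 (x 2) (x 3) * productEq f g (x 0) 1 (x 2)
        (x 3) - E (x 0) 1 (x 2) (x 3) * productEq f g (x 0) 0 (x 2) (x 3)) ?_ ?_ ![u, 0, u2, u12]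
      · simp only [hcE, productEq, hf, hg, Fin.sum_univ_two]
        fun_prop
      · refine ((d1.and r1).and g02).mono fun x hx => ?_
        obtain ⟨⟨hd, hr⟩, hg02⟩ := hx
        refine affine_cross_eq_zero (e := fun s => E _ s _ _)
          (h := fun s => productEq f g _ s _ _) (fun _ => e1 _ _ _ _) (fun _ => k1 _ _ _ _) hd ?_
        intro t ht
        simp only [productEq] at ht
        refine (hz _ _ _ _ (fun h => hr ?_) hg02).1 ht
        have h' : g t (x 3) = 0 := by
          rw [h] at ht
          simpa [hg02] using ht
        rw [hf] at h
        rw [hg] at h'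
        linear_combination (b1 + b3 * x 3) * h - (a2 + a3 * x 0) * h'
    · intro u u1 s t u12
      refine affine_cross_eq (e := fun s => E u u1 s u12)
        (h := fun s => productEq f g u u1 s u12) (fun _ => e2 _ _ _ _) (fun _ => k2 _ _ _ _) ?_ s t
      refine Generically.eq_zero (f := fun x => E (x 0) (x 1) 0 (x 3) * productEq f g (x 0) (x 1) 1
        (x 3) - E (x 0) (x 1) 1 (x 3) * productEq f g (x 0) (x 1) 0 (x 3)) ?_ ?_ ![u, u1, 0, u12]
      · simp only [hcE, productEq, hf, hg, Fin.sum_univ_two]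
        fun_prop
      · refine ((d2.and r2).and f01).mono fun x hx => ?_
        obtain ⟨⟨hd, hr⟩, hf01⟩ := hx
        refine affine_cross_eq_zero (e := fun s => E _ _ s _)
          (h := fun s => productEq f g _ _ s _) (fun _ => e2 _ _ _ _) (fun _ => k2 _ _ _ _) hd ?_
        intro t ht
        simp only [productEq] at ht
        refine (hz _ _ _ _ hf01 (fun h => hr ?_)).1 ht
        have h' : f t (x 3) = 0 := by
          rw [h] at ht
          simpa [hf01] using ht
        rw [hg] at h
        rw [hf] at h'
        linear_combination (a1 + a3 * x 3) * h - (b2 + b3 * x 0) * h'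
    · intro u u1 u2 s t
      refine affine_cross_eq (e := fun s => E u u1 u2 s)
        (h := fun s => productEq f g u u1 u2 s) (fun _ => e3 _ _ _ _) (fun _ => k3 _ _ _ _) ?_ s t
      refine Generically.eq_zero (f := fun x => E (x 0) (x 1) (x 2) 0 * productEq f g (x 0) (x 1)
        (x 2) 1 - E (x 0) (x 1) (x 2) 1 * productEq f g (x 0) (x 1) (x 2) 0) ?_ ?_ ![u, u1, u2, 0]
      · simp only [hcE, productEq, hf, hg, Fin.sum_univ_two]
        fun_prop
      -- The excluded set does not involve `ũ̂`, so no resultant is needed in this direction.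
      · refine ((d3.and f01).and g02).mono fun x hx => ?_
        obtain ⟨⟨hd, hf01⟩, hg02⟩ := hx
        exact affine_cross_eq_zero (e := fun s => E _ _ _ s)
          (h := fun s => productEq f g _ _ _ s) (fun _ => e3 _ _ _ _) (fun _ => k3 _ _ _ _) hd
          fun t ht => (hz _ _ _ _ hf01 hg02).1 ht
  refine ⟨κ, ?_, hκ⟩
  rintro rfl
  -- If `E` vanished identically, so would `productEq` off the excluded set, against its nonzero
  -- slope in `ũ̂`.
  obtain ⟨x, ⟨hd, hf01⟩, hg02⟩ := ((d3.and f01).and g02).exists_of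
  apply hd
  rw [(hz _ _ _ _ hf01 hg02).2 (by rw [hκ, zero_mul]), (hz _ _ _ _ hf01 hg02).2
    (by rw [hκ, zero_mul]), sub_zero]

/-! ### Consistency of the listed equations around the cube -/

/-- The last step on the cube: if the left-hand side on the face at `u3`, cleared of denominators,
is a multiple of `M x + N`, then `-N / M` is the unique solution. -/
theorem face_eq_zero_iff {Q A A' K M N x : ℂ} (h : Q * (A * A') = K * (M * x + N))
    (hA : A ≠ 0) (hA' : A' ≠ 0) (hK : K ≠ 0) (hM : M ≠ 0) : Q = 0 ↔ x = -N / M := by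
  have h1 : Q = 0 ↔ M * x + N = 0 := by
    rw [← mul_eq_zero_iff_right (mul_ne_zero hA hA'), mul_comm, mul_comm (A * A'), h,
      mul_eq_zero_iff_left hK]
  rw [h1, eq_div_iff hM]
  constructor <;> intro h <;> linear_combination h

/-- A sufficient condition for consistency around the cube and the tetrahedron property, in terms of
the coefficients of a quadrilateral equation `A x + B = 0` and of a factorization of the left-hand
side for the last vertex of the cube. -/
theorem consistentAroundCube_of_factorization {Λ : Type*} {Q : Λ → Λ → QuadFn}
    (A B : Λ → Λ → ℂ → ℂ → ℂ → ℂ) (K : Λ → Λ → Λ → ℂ → ℂ → ℂ → ℂ → ℂ)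
    (M N : Λ → Λ → Λ → ℂ → ℂ → ℂ → ℂ)
    (hQ : ∀ p q u u1 u2 x, Q p q u u1 u2 x = A p q u u1 u2 * x + B p q u u1 u2)
    (hA : ∀ p q u u1 u2, A q p u u2 u1 = -A p q u u1 u2)
    (hB : ∀ p q u u1 u2, B q p u u2 u1 = -B p q u u1 u2)
    (hM : ∀ p q r u1 u2 u3, M p r q u1 u3 u2 = -M p q r u1 u2 u3 ∧
      M q r p u2 u3 u1 = M p q r u1 u2 u3)
    (hN : ∀ p q r u1 u2 u3, N p r q u1 u3 u2 = -N p q r u1 u2 u3 ∧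
      N q r p u2 u3 u1 = N p q r u1 u2 u3)
    (hK : ∀ p q r u u1 u2 u3 x, A p r u u1 u3 ≠ 0 → A q r u u2 u3 ≠ 0 →
      Q p q u3 (-B p r u u1 u3 / A p r u u1 u3) (-B q r u u2 u3 / A q r u u2 u3) x *
        (A p r u u1 u3 * A q r u u2 u3) =
      K p q r u u1 u2 u3 * (M p q r u1 u2 u3 * x + N p q r u1 u2 u3))
    (pA : ∀ p q i j, IsPolynomialFun fun x => A p q (x 0) (x i) (x j))
    (pK : ∀ p q r i j k, IsPolynomialFun fun x => K p q r (x 0) (x i) (x j) (x k))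
    (pM : ∀ p q r, IsPolynomialFun fun x => M p q r (x 1) (x 2) (x 3))
    (nA : ∀ p q, p ≠ q → ∃ u u1 u2, A p q u u1 u2 ≠ 0)
    (nK : ∀ p q r, p ≠ q → p ≠ r → q ≠ r → ∃ u u1 u2 u3, K p q r u u1 u2 u3 ≠ 0)
    (nM : ∀ p q r, p ≠ q → p ≠ r → q ≠ r → ∃ u1 u2 u3, M p q r u1 u2 u3 ≠ 0) :
    ConsistentAroundCube Q ∧ TetrahedronProperty Q := by
  have sol : ∀ p q u u1 u2, A p q u u1 u2 ≠ 0 → ∀ x,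
      Q p q u u1 u2 x = 0 ↔ x = -B p q u u1 u2 / A p q u u1 u2 := by
    intro p q u u1 u2 h x
    rw [hQ, eq_div_iff h]
    constructor <;> intro h <;> linear_combination h
  -- All divisors met on the six faces are nonzero at generic initial values.
  have gen : ∀ p q r, p ≠ q → p ≠ r → q ≠ r → Generically fun x =>
      (A p q (x 0) (x 1) (x 2) ≠ 0 ∧ A p r (x 0) (x 1) (x 3) ≠ 0 ∧ A q r (x 0) (x 2) (x 3) ≠ 0) ∧
      (K p q r (x 0) (x 1) (x 2) (x 3) ≠ 0 ∧ K p r q (x 0) (x 1) (x 3) (x 2) ≠ 0 ∧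
        K q r p (x 0) (x 2) (x 3) (x 1) ≠ 0) ∧ M p q r (x 1) (x 2) (x 3) ≠ 0 := by
    intro p q r hpq hpr hqr
    obtain ⟨a0, a1, a2, ha⟩ := nA p q hpq
    obtain ⟨b0, b1, b3, hb⟩ := nA p r hpr
    obtain ⟨c0, c2, c3, hc⟩ := nA q r hqr
    obtain ⟨k0, k1, k2, k3, hk⟩ := nK p q r hpq hpr hqr
    obtain ⟨l0, l1, l3, l2, hl⟩ := nK p r q hpr hpq hqr.symm
    obtain ⟨m0, m2, m3, m1, hm⟩ := nK q r p hqr hpq.symm hpr.symm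
    obtain ⟨n1, n2, n3, hn⟩ := nM p q r hpq hpr hqr
    exact ((Generically.ne_zero (pA _ _ _ _) ⟨![a0, a1, a2, 0], ha⟩).and
      ((Generically.ne_zero (pA _ _ _ _) ⟨![b0, b1, 0, b3], hb⟩).and
      (Generically.ne_zero (pA _ _ _ _) ⟨![c0, 0, c2, c3], hc⟩))).and
      (((Generically.ne_zero (pK _ _ _ _ _ _) ⟨![k0, k1, k2, k3], hk⟩).and
      ((Generically.ne_zero (pK _ _ _ _ _ _) ⟨![l0, l1, l2, l3], hl⟩).and
      (Generically.ne_zero (pK _ _ _ _ _ _) ⟨![m0, m1, m2, m3], hm⟩))).and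
      (Generically.ne_zero (pM _ _ _) ⟨![0, n1, n2, n3], hn⟩))
  constructor
  · intro p q r hpq hpr hqr
    refine (generically_iff _).2 ((gen p q r hpq hpr hqr).mono ?_)
    intro x hx
    generalize x 0 = u, x 1 = u1, x 2 = u2, x 3 = u3 at hx
    obtain ⟨⟨h12, h13, h23⟩, ⟨k3, k2, k1⟩, hm⟩ := hx
    refine ⟨-N p q r u1 u2 u3 / M p q r u1 u2 u3, _, _, _, sol p q u u1 u2 h12,
      sol p r u u1 u3 h13, sol q r u u2 u3 h23, fun y => ?_, fun y => ?_, fun y => ?_⟩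
    · exact face_eq_zero_iff (hK p q r u u1 u2 u3 y h13 h23) h13 h23 k3 hm
    -- The face at `u2` is the face at `u3` with `q` and `r` exchanged. The signs of `A` and `B`
    -- cancel in `u23`, those of `M` and `N` in the final value.
    · have h32 : A r q u u3 u2 ≠ 0 := by rw [hA]; exact neg_ne_zero.2 h23
      have := hK p r q u u1 u3 u2 y h12 h32
      rw [(hM p q r u1 u2 u3).1, (hN p q r u1 u2 u3).1] at this
      rw [hA q r u u2 u3, hB q r u u2 u3, neg_div_neg_eq, ← hA q r u u2 u3] at this
      rw [face_eq_zero_iff this h12 h32 k2 (neg_ne_zero.2 hm), neg_div_neg_eq, neg_div, ← div_neg]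
    · have h21 : A q p u u2 u1 ≠ 0 := by rw [hA]; exact neg_ne_zero.2 h12
      have h31 : A r p u u3 u1 ≠ 0 := by rw [hA]; exact neg_ne_zero.2 h13
      have := hK q r p u u2 u3 u1 y h21 h31
      rw [(hM p q r u1 u2 u3).2, (hN p q r u1 u2 u3).2] at this
      rw [hA p q u u1 u2, hB p q u u1 u2, neg_div_neg_eq, ← hA p q u u1 u2,
        hA p r u u1 u3, hB p r u u1 u3, neg_div_neg_eq, ← hA p r u u1 u3] at this
      exact face_eq_zero_iff this h21 h31 k1 hm
  · intro p q r hpq hpr hqr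
    obtain ⟨D, hD, h⟩ := gen p q r hpq hpr hqr
    -- The value at the last vertex is `-N / M`, where `u` does not occur.
    have key : ∀ u u1 u2 u3 v, MvPolynomial.eval ![u, u1, u2, u3] D ≠ 0 →
        CubeValue Q p q r u u1 u2 u3 v → v = -N p q r u1 u2 u3 / M p q r u1 u2 u3 := by
      intro u u1 u2 u3 v hd hv
      obtain ⟨⟨-, h13, h23⟩, ⟨k3, -, -⟩, hm⟩ := h _ hd
      obtain ⟨-, u13, u23, -, e13, e23, e, -⟩ := hv
      rw [← face_eq_zero_iff (hK p q r u u1 u2 u3 v h13 h23) h13 h23 k3 hm]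
      rw [(e13 _).1 ((sol p r u u1 u3 h13 _).2 rfl), (e23 _).1 ((sol q r u u2 u3 h23 _).2 rfl)]
      exact (e v).2 rfl
    exact ⟨D, hD, fun u u' u1 u2 u3 v v' h1 h2 h3 h4 =>
      (key _ _ _ _ _ h1 h3).trans (key _ _ _ _ _ h2 h4).symm⟩

/-- The three coefficients vanish together only if `a = b = c`. This and its two variants show that
the coefficient `M` of the last vertex is not identically zero. -/
theorem exists_linear_ne_zero {a b c : ℂ} (h : ¬(a = b ∧ b = c)) :
    ∃ x y z, (b - c) * x + (c - a) * y + (a - b) * z ≠ 0 := by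
  by_cases hbc : b = c
  · exact ⟨0, 0, 1, by simpa using sub_ne_zero.2 fun hab => h ⟨hab, hbc⟩⟩
  · exact ⟨1, 0, 0, by simpa using sub_ne_zero.2 hbc⟩

theorem exists_linear_ne_zero' {a b c : ℂ} (h : ¬(a = b ∧ b = c)) :
    ∃ x y z, (c - b) * x + (a - c) * y + (b - a) * z ≠ 0 := by
  obtain ⟨x, y, z, h⟩ := exists_linear_ne_zero h
  exact ⟨-x, -y, -z, by convert h using 1; ring⟩

theorem exists_quadratic_ne_zero {a b c : ℂ} (ha : a ≠ 0) (hb : b ≠ 0) (hc : c ≠ 0)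
    (h : ¬(a ^ 2 = b ^ 2 ∧ b ^ 2 = c ^ 2)) : ∃ x y z,
    a * (b ^ 2 - c ^ 2) * x + b * (c ^ 2 - a ^ 2) * y + c * (a ^ 2 - b ^ 2) * z ≠ 0 := by
  obtain ⟨x, y, z, h⟩ := exists_linear_ne_zero h
  exact ⟨x / a, y / b, z / c, by convert h using 1; field_simp⟩

/-- H1 is consistent around the cube and has the tetrahedron property. -/
theorem consistentAroundCube_eqH1 {Λ : Type*} {P : Λ → ℂ} (hP : Function.Injective P) :
    ConsistentAroundCube (fun p q => eqH1 (P p) (P q)) ∧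
      TetrahedronProperty (fun p q => eqH1 (P p) (P q)) := by
  refine consistentAroundCube_of_factorization
    (fun p q u u1 u2 => u2 - u1)
    (fun p q u u1 u2 => u * (u1 - u2) - P p + P q)
    (fun p q r u u1 u2 u3 => 1)
    (fun p q r u1 u2 u3 => (P r - P q) * u1 + (P p - P r) * u2 + (P q - P p) * u3)
    (fun p q r u1 u2 u3 => (P q - P p) * u1 * u2 + (P r - P q) * u2 * u3 + (P p - P r) * u1 * u3)
    ?_ ?_ ?_ ?_ ?_ ?_ ?_ ?_ ?_ (fun p q h => ⟨0, 0, 1, by simp⟩) (fun p q r h1 h2 h3 => ⟨0, 0, 0, 0, one_ne_zero⟩)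
    (fun p q r h1 h2 h3 => exists_linear_ne_zero' fun h => h1 (hP h.1))
  · intros
    simp only [eqH1]
    ring
  · intros
    ring
  · intros
    ring
  · intros
    constructor <;> ring
  · intros
    constructor <;> ring
  · intro p q r u u1 u2 u3 x h1 h2
    simp only [eqH1] at *
    -- The two denominators become atoms while fractions are cleared, and are put back for the
    -- polynomial identity.
    generalize hd : u3 - u1 = d at h1 ⊢
    generalize he : u3 - u2 = e at h2 ⊢
    field_simp
    rw [← hd, ← he]
    ring
  all_goals
    intros
    fun_prop

/-- H2 is consistent around the cube and has the tetrahedron property. -/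
theorem consistentAroundCube_eqH2 {Λ : Type*} {P : Λ → ℂ} (hP : Function.Injective P) :
    ConsistentAroundCube (fun p q => eqH2 (P p) (P q)) ∧
      TetrahedronProperty (fun p q => eqH2 (P p) (P q)) := by
  refine consistentAroundCube_of_factorization
    (fun p q u u1 u2 => u2 - u1 - (P p - P q))
    (fun p q u u1 u2 => u * (u1 - u2) - (P p - P q) * (u + u1 + u2 + P p + P q))
    (fun p q r u u1 u2 u3 => 2 * (u + u3 + P r))
    (fun p q r u1 u2 u3 => (P r - P q) * u1 + (P p - P r) * u2 + (P q - P p) * u3)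
    (fun p q r u1 u2 u3 => (P q - P p) * u1 * u2 + (P r - P q) * u2 * u3 + (P p - P r) * u1 * u3
      + (P p - P q) * (P q - P r) * (P p - P r))
    ?_ ?_ ?_ ?_ ?_ ?_ ?_ ?_ ?_ (fun p q h => ⟨0, 0, 1 + (P p - P q), by simp⟩) (fun p q r h1 h2 h3 => ⟨1 - P r, 0, 0, 0, by simp⟩)
    (fun p q r h1 h2 h3 => exists_linear_ne_zero' fun h => h1 (hP h.1))
  · intros
    simp only [eqH2]
    ring
  · intros
    ring
  · intros
    ring
  · intros
    constructor <;> ring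
  · intros
    constructor <;> ring
  · intro p q r u u1 u2 u3 x h1 h2
    simp only [eqH2] at *
    generalize hd : u3 - u1 - (P p - P r) = d at h1 ⊢
    generalize he : u3 - u2 - (P q - P r) = e at h2 ⊢
    field_simp
    rw [← hd, ← he]
    ring
  all_goals
    intros
    fun_prop

/-- H3(δ) is consistent around the cube and has the tetrahedron property. -/
theorem consistentAroundCube_eqH3 {Λ : Type*} (δ : ℂ) {P : Λ → ℂ} (hP : ∀ p, P p ≠ 0)
    (hP' : ∀ p q r, p ≠ q → p ≠ r → q ≠ r → ¬(P p ^ 2 = P q ^ 2 ∧ P q ^ 2 = P r ^ 2)) :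
    ConsistentAroundCube (fun p q => eqH3 δ (P p) (P q)) ∧
      TetrahedronProperty (fun p q => eqH3 δ (P p) (P q)) := by
  refine consistentAroundCube_of_factorization
    (fun p q u u1 u2 => P p * u2 - P q * u1)
    (fun p q u u1 u2 => P p * (u * u1) - P q * (u * u2) + δ * (P p ^ 2 - P q ^ 2))
    (fun p q r u u1 u2 u3 => u * u3 + δ * P r)
    (fun p q r u1 u2 u3 => P p * (P q ^ 2 - P r ^ 2) * u1 + P q * (P r ^ 2 - P p ^ 2) * u2
      + P r * (P p ^ 2 - P q ^ 2) * u3)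
    (fun p q r u1 u2 u3 => P r * (P p ^ 2 - P q ^ 2) * u1 * u2 + P p * (P q ^ 2 - P r ^ 2) * u2 * u3
      + P q * (P r ^ 2 - P p ^ 2) * u1 * u3)
    ?_ ?_ ?_ ?_ ?_ ?_ ?_ ?_ ?_ (fun p q h => ⟨0, 0, 1, by simp [hP]⟩) (fun p q r h1 h2 h3 => ⟨1, 0, 0, 1 - δ * P r, by simp⟩)
    (fun p q r h1 h2 h3 => exists_quadratic_ne_zero (hP p) (hP q) (hP r) (hP' p q r h1 h2 h3))
  · intros
    simp only [eqH3]
    ring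
  · intros
    ring
  · intros
    ring
  · intros
    constructor <;> ring
  · intros
    constructor <;> ring
  · intro p q r u u1 u2 u3 x h1 h2
    simp only [eqH3] at *
    generalize hd : P p * u3 - P r * u1 = d at h1 ⊢
    generalize he : P q * u3 - P r * u2 = e at h2 ⊢
    field_simp
    rw [← hd, ← he]
    ring
  all_goals
    intros
    fun_prop

/-- A1(δ) is consistent around the cube and has the tetrahedron property. -/
theorem consistentAroundCube_eqA1 {Λ : Type*} (δ : ℂ) {P : Λ → ℂ} (hP : ∀ p, P p ≠ 0)
    (hP' : ∀ p q r, p ≠ q → p ≠ r → q ≠ r → ¬(P p = P q ∧ P q = P r)) :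
    ConsistentAroundCube (fun p q => eqA1 δ (P p) (P q)) ∧
      TetrahedronProperty (fun p q => eqA1 δ (P p) (P q)) := by
  refine consistentAroundCube_of_factorization
    (fun p q u u1 u2 => P p * (u + u2) - P q * (u + u1))
    (fun p q u u1 u2 => P p * (u + u2) * u1 - P q * (u + u1) * u2 - δ ^ 2 * P p * P q * (P p - P q))
    (fun p q r u u1 u2 u3 => P p * P q * ((u + u3) ^ 2 - δ ^ 2 * P r ^ 2))
    (fun p q r u1 u2 u3 => (P q - P r) * u1 + (P r - P p) * u2 + (P p - P q) * u3)
    (fun p q r u1 u2 u3 => (P p - P q) * u1 * u2 + (P q - P r) * u2 * u3 + (P r - P p) * u1 * u3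
      - δ ^ 2 * ((P p - P q) * (P q - P r) * (P p - P r)))
    ?_ ?_ ?_ ?_ ?_ ?_ ?_ ?_ ?_ (fun p q h => ⟨0, 0, 1, by simp [hP]⟩) (fun p q r h1 h2 h3 => by
      by_cases h : δ = 0
      · exact ⟨1, 0, 0, 0, by simp [h, hP]⟩
      · exact ⟨0, 0, 0, 0, by simp [h, hP]⟩)
    (fun p q r h1 h2 h3 => exists_linear_ne_zero (hP' p q r h1 h2 h3))
  · intros
    simp only [eqA1]
    ring
  · intros
    ring
  · intros
    ring
  · intros
    constructor <;> ring
  · intros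
    constructor <;> ring
  · intro p q r u u1 u2 u3 x h1 h2
    simp only [eqA1] at *
    generalize hd : P p * (u + u3) - P r * (u + u1) = d at h1 ⊢
    generalize he : P q * (u + u3) - P r * (u + u2) = e at h2 ⊢
    field_simp
    rw [← hd, ← he]
    ring
  all_goals
    intros
    fun_prop

/-- Q1(0) is consistent around the cube and has the tetrahedron property. -/
theorem consistentAroundCube_eqQ1 {Λ : Type*} {P : Λ → ℂ} (hP : ∀ p, P p ≠ 0)
    (hP' : ∀ p q r, p ≠ q → p ≠ r → q ≠ r → ¬(P p = P q ∧ P q = P r)) :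
    ConsistentAroundCube (fun p q => eqQ1 0 (P p) (P q)) ∧
      TetrahedronProperty (fun p q => eqQ1 0 (P p) (P q)) := by
  refine consistentAroundCube_of_factorization
    (fun p q u u1 u2 => -(P p * (u - u2)) + P q * (u - u1))
    (fun p q u u1 u2 => P p * (u - u2) * u1 - P q * (u - u1) * u2)
    (fun p q r u u1 u2 u3 => P p * P q * (u - u3) ^ 2)
    (fun p q r u1 u2 u3 => (P r - P q) * u1 + (P p - P r) * u2 + (P q - P p) * u3)
    (fun p q r u1 u2 u3 => (P q - P p) * u1 * u2 + (P r - P q) * u2 * u3 + (P p - P r) * u1 * u3)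
    ?_ ?_ ?_ ?_ ?_ ?_ ?_ ?_ ?_ (fun p q h => ⟨0, 0, 1, by simp [hP]⟩) (fun p q r h1 h2 h3 => ⟨1, 0, 0, 0, by simp [hP]⟩)
    (fun p q r h1 h2 h3 => exists_linear_ne_zero' (hP' p q r h1 h2 h3))
  · intros
    simp only [eqQ1]
    ring
  · intros
    ring
  · intros
    ring
  · intros
    constructor <;> ring
  · intros
    constructor <;> ring
  · intro p q r u u1 u2 u3 x h1 h2
    simp only [eqQ1] at *
    generalize hd : -(P p * (u - u3)) + P r * (u - u1) = d at h1 ⊢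
    generalize he : -(P q * (u - u3)) + P r * (u - u2) = e at h2 ⊢
    field_simp
    rw [← hd, ← he]
    ring
  all_goals
    intros
    fun_prop

/-- The lattice potential modified KdV equation is consistent around the cube and has the tetrahedron property. -/
theorem consistentAroundCube_eqLpmKdV {Λ : Type*} {P : Λ → ℂ} (hP : ∀ p, P p ≠ 0)
    (hP' : ∀ p q r, p ≠ q → p ≠ r → q ≠ r → ¬(P p ^ 2 = P q ^ 2 ∧ P q ^ 2 = P r ^ 2)) :
    ConsistentAroundCube (fun p q => eqLpmKdV (P p) (P q)) ∧
      TetrahedronProperty (fun p q => eqLpmKdV (P p) (P q)) := by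
  refine consistentAroundCube_of_factorization
    (fun p q u u1 u2 => P q * u1 - P p * u2)
    (fun p q u u1 u2 => P p * (u * u1) - P q * (u * u2))
    (fun p q r u u1 u2 u3 => u * u3)
    (fun p q r u1 u2 u3 => P p * (P q ^ 2 - P r ^ 2) * u1 + P q * (P r ^ 2 - P p ^ 2) * u2
      + P r * (P p ^ 2 - P q ^ 2) * u3)
    (fun p q r u1 u2 u3 => -(P r * (P p ^ 2 - P q ^ 2) * u1 * u2 + P p * (P q ^ 2 - P r ^ 2) * u2 * u3
      + P q * (P r ^ 2 - P p ^ 2) * u1 * u3))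
    ?_ ?_ ?_ ?_ ?_ ?_ ?_ ?_ ?_ (fun p q h => ⟨0, 0, 1, by simp [hP]⟩) (fun p q r h1 h2 h3 => ⟨1, 0, 0, 1, by simp⟩)
    (fun p q r h1 h2 h3 => exists_quadratic_ne_zero (hP p) (hP q) (hP r) (hP' p q r h1 h2 h3))
  · intros
    simp only [eqLpmKdV]
    ring
  · intros
    ring
  · intros
    ring
  · intros
    constructor <;> ring
  · intros
    constructor <;> ring
  · intro p q r u u1 u2 u3 x h1 h2
    simp only [eqLpmKdV] at *
    generalize hd : P r * u1 - P p * u3 = d at h1 ⊢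
    generalize he : P r * u2 - P q * u3 = e at h2 ⊢
    field_simp
    rw [← hd, ← he]
    ring
  all_goals
    intros
    fun_prop

/-- A2 is consistent around the cube and has the tetrahedron property. -/
theorem consistentAroundCube_eqA2 {Λ : Type*} {P : Λ → ℂ} (hP : ∀ p, P p ≠ 0)
    (hP1 : ∀ p, 1 - P p ^ 2 ≠ 0)
    (hP' : ∀ p q r, p ≠ q → p ≠ r → q ≠ r → ¬(P p ^ 2 = P q ^ 2 ∧ P q ^ 2 = P r ^ 2)) :
    ConsistentAroundCube (fun p q => eqA2 (P p) (P q)) ∧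
      TetrahedronProperty (fun p q => eqA2 (P p) (P q)) := by
  refine consistentAroundCube_of_factorization
    (fun p q u u1 u2 => P p * (1 - P q ^ 2) * u2 - P q * (1 - P p ^ 2) * u1 - (P p ^ 2 - P q ^ 2) * (u * u1 * u2))
    (fun p q u u1 u2 => P p * (1 - P q ^ 2) * (u * u1) - P q * (1 - P p ^ 2) * (u * u2) - (P p ^ 2 - P q ^ 2))
    (fun p q r u u1 u2 u3 => -((1 - P p ^ 2) * (1 - P q ^ 2) * (P r - u * u3) * (1 - P r * (u * u3))))
    (fun p q r u1 u2 u3 => P p * (P q ^ 2 - P r ^ 2) * u1 + P q * (P r ^ 2 - P p ^ 2) * u2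
      + P r * (P p ^ 2 - P q ^ 2) * u3)
    (fun p q r u1 u2 u3 => P r * (P p ^ 2 - P q ^ 2) * u1 * u2 + P p * (P q ^ 2 - P r ^ 2) * u2 * u3
      + P q * (P r ^ 2 - P p ^ 2) * u1 * u3)
    ?_ ?_ ?_ ?_ ?_ ?_ ?_ ?_ ?_ (fun p q h => ⟨0, 0, 1, by simp [hP, hP1]⟩) (fun p q r h1 h2 h3 => ⟨0, 0, 0, 0, by simp [hP, hP1]⟩)
    (fun p q r h1 h2 h3 => exists_quadratic_ne_zero (hP p) (hP q) (hP r) (hP' p q r h1 h2 h3))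
  · intros
    simp only [eqA2]
    ring
  · intros
    ring
  · intros
    ring
  · intros
    constructor <;> ring
  · intros
    constructor <;> ring
  · intro p q r u u1 u2 u3 x h1 h2
    simp only [eqA2] at *
    generalize hd : P p * (1 - P r ^ 2) * u3 - P r * (1 - P p ^ 2) * u1 - (P p ^ 2 - P r ^ 2) * (u * u1 * u3) = d at h1 ⊢
    generalize he : P q * (1 - P r ^ 2) * u3 - P r * (1 - P q ^ 2) * u2 - (P q ^ 2 - P r ^ 2) * (u * u2 * u3) = e at h2 ⊢
    field_simp
    rw [← hd, ← he]
    ring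
  all_goals
    intros
    fun_prop

/-- H3(1) in the inverse variables is consistent around the cube and has the tetrahedron property. -/
theorem consistentAroundCube_eqH3Inv {Λ : Type*} {P : Λ → ℂ} (hP : ∀ p, P p ≠ 0)
    (hP' : ∀ p q r, p ≠ q → p ≠ r → q ≠ r → ¬(P p ^ 2 = P q ^ 2 ∧ P q ^ 2 = P r ^ 2)) :
    ConsistentAroundCube (fun p q => eqH3Inv (P p) (P q)) ∧
      TetrahedronProperty (fun p q => eqH3Inv (P p) (P q)) := by
  refine consistentAroundCube_of_factorization
    (fun p q u u1 u2 => P p * u2 - P q * u1 + (P p ^ 2 - P q ^ 2) * (u * u1 * u2))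
    (fun p q u u1 u2 => P p * (u * u1) - P q * (u * u2))
    (fun p q r u u1 u2 u3 => u * u3 * (1 + P r * (u * u3)))
    (fun p q r u1 u2 u3 => P p * (P q ^ 2 - P r ^ 2) * u1 + P q * (P r ^ 2 - P p ^ 2) * u2
      + P r * (P p ^ 2 - P q ^ 2) * u3)
    (fun p q r u1 u2 u3 => P r * (P p ^ 2 - P q ^ 2) * u1 * u2 + P p * (P q ^ 2 - P r ^ 2) * u2 * u3
      + P q * (P r ^ 2 - P p ^ 2) * u1 * u3)
    ?_ ?_ ?_ ?_ ?_ ?_ ?_ ?_ ?_ (fun p q h => ⟨0, 0, 1, by simp [hP]⟩) (fun p q r h1 h2 h3 => ⟨1, 0, 0, 1 / P r, by simp [hP]⟩)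
    (fun p q r h1 h2 h3 => exists_quadratic_ne_zero (hP p) (hP q) (hP r) (hP' p q r h1 h2 h3))
  · intros
    simp only [eqH3Inv]
    ring
  · intros
    ring
  · intros
    ring
  · intros
    constructor <;> ring
  · intros
    constructor <;> ring
  · intro p q r u u1 u2 u3 x h1 h2
    simp only [eqH3Inv] at *
    generalize hd : P p * u3 - P r * u1 + (P p ^ 2 - P r ^ 2) * (u * u1 * u3) = d at h1 ⊢
    generalize he : P q * u3 - P r * u2 + (P q ^ 2 - P r ^ 2) * (u * u2 * u3) = e at h2 ⊢
    field_simp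
    rw [← hd, ← he]
    ring
  all_goals
    intros
    fun_prop

/-- The equation `eqNew` is consistent around the cube and has the tetrahedron property. -/
theorem consistentAroundCube_eqNew {Λ : Type*} {P : Λ → ℂ} (hP : ∀ p, P p ≠ 0)
    (hP' : ∀ p q r, p ≠ q → p ≠ r → q ≠ r → ¬(P p ^ 2 = P q ^ 2 ∧ P q ^ 2 = P r ^ 2)) :
    ConsistentAroundCube (fun p q => eqNew (P p) (P q)) ∧
      TetrahedronProperty (fun p q => eqNew (P p) (P q)) := by
  refine consistentAroundCube_of_factorization
    (fun p q u u1 u2 => P q ^ 2 * ((u * u1 - 1) * u2) - P p ^ 2 * ((u * u2 - 1) * u1))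
    (fun p q u u1 u2 => P p ^ 2 * (u * u2 - 1) - P q ^ 2 * (u * u1 - 1))
    (fun p q r u u1 u2 u3 => P p ^ 2 * P q ^ 2 * (u * u3 - 1) ^ 2)
    (fun p q r u1 u2 u3 => (P r ^ 2 - P q ^ 2) * u1 + (P p ^ 2 - P r ^ 2) * u2 + (P q ^ 2 - P p ^ 2) * u3)
    (fun p q r u1 u2 u3 => (P q ^ 2 - P p ^ 2) * u1 * u2 + (P r ^ 2 - P q ^ 2) * u2 * u3 + (P p ^ 2 - P r ^ 2) * u1 * u3)
    ?_ ?_ ?_ ?_ ?_ ?_ ?_ ?_ ?_ (fun p q h => ⟨0, 0, 1, by simp [hP]⟩) (fun p q r h1 h2 h3 => ⟨0, 0, 0, 0, by simp [hP]⟩)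
    (fun p q r h1 h2 h3 => exists_linear_ne_zero' (hP' p q r h1 h2 h3))
  · intros
    simp only [eqNew]
    ring
  · intros
    ring
  · intros
    ring
  · intros
    constructor <;> ring
  · intros
    constructor <;> ring
  · intro p q r u u1 u2 u3 x h1 h2
    simp only [eqNew] at *
    generalize hd : P r ^ 2 * ((u * u1 - 1) * u3) - P p ^ 2 * ((u * u3 - 1) * u1) = d at h1 ⊢
    generalize he : P r ^ 2 * ((u * u2 - 1) * u3) - P q ^ 2 * ((u * u3 - 1) * u2) = e at h2 ⊢
    field_simp
    rw [← hd, ← he]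
    ring
  all_goals
    intros
    fun_prop


/-! ### Compatibility conditions of the two-component system -/

/-- The compatibility condition with respect to `u` of `s₀ + s₁ u + s₂ ũ = U Ũ`. -/
def linearEq (a0 a1 a2 b0 b1 b2 : ℂ) : QuadFn := fun U U1 U2 U12 =>
  b1 * U * U1 + b2 * U2 * U12 - a1 * U * U2 - a2 * U1 * U12 - a0 * (b1 + b2) + b0 * (a1 + a2)

/-- The two equations prescribe `U12` as `c / U2` and as `d / U1`. Cross-multiplication and a factor
`U` turn the equality of these into `a c = b d`. -/
theorem exists_common_factor_iff {a b c d U U1 U2 : ℂ} (hU : U ≠ 0) (h1 : U1 ≠ 0) (h2 : U2 ≠ 0)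
    (ha : a = U * U1) (hb : b = U * U2) :
    (∃ U12, c = U2 * U12 ∧ d = U1 * U12) ↔ a * c - b * d = 0 := by
  subst ha hb
  constructor
  · rintro ⟨U12, rfl, rfl⟩
    ring
  · intro h
    refine ⟨c / U2, by field_simp, ?_⟩
    field_simp
    apply mul_left_cancel₀ hU
    linear_combination -h

/-- In the combination of the four edge relations with weights `-b1, a1, -b2, a2` all values of `u`
cancel, and `linearEq` remains. -/
theorem exists_common_value_iff {a0 a1 a2 b0 b1 b2 u u1 u2 U U1 U2 U12 : ℂ} (ha : a2 ≠ 0)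
    (hb : b2 ≠ 0) (h1 : a0 + a1 * u + a2 * u1 = U * U1) (h2 : b0 + b1 * u + b2 * u2 = U * U2) :
    (∃ u12, a0 + a1 * u2 + a2 * u12 = U2 * U12 ∧ b0 + b1 * u1 + b2 * u12 = U1 * U12) ↔
      linearEq a0 a1 a2 b0 b1 b2 U U1 U2 U12 = 0 := by
  simp only [linearEq]
  constructor
  · rintro ⟨u12, h3, h4⟩
    linear_combination -b1 * h1 + a1 * h2 - b2 * h3 + a2 * h4
  · intro h
    refine ⟨(U2 * U12 - a0 - a1 * u2) / a2, by field_simp; ring, ?_⟩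
    field_simp
    linear_combination h + b1 * h1 - a1 * h2

/-- The value of `U` at the base vertex may be normalized to 1; then `Ũ` and `Û` are the values of
`h`, and their nonvanishing is the only restriction left. -/
theorem compatYields_swap_iff {Λ : Type*} {h : Λ → ℂ → ℂ → ℂ} {E : Λ → Λ → QuadFn} :
    CompatYields (fun p U U1 u u1 => h p u u1 = U * U1) E ↔ ∀ p q, p ≠ q → ∀ u u1 u2 u12,
      h p u u1 ≠ 0 → h q u u2 ≠ 0 →
        (productEq (h p) (h q) u u1 u2 u12 = 0 ↔ E p q u u1 u2 u12 = 0) := by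
  constructor
  · intro hc p q hpq u u1 u2 u12 h1 h2
    rw [← hc p q hpq 1 (h p u u1) (h q u u2) u u1 u2 u12 one_ne_zero h1 h2 (one_mul _).symm
      (one_mul _).symm]
    exact (exists_common_factor_iff one_ne_zero h1 h2 (one_mul _).symm (one_mul _).symm).symm
  · intro hc p q hpq U U1 U2 u u1 u2 u12 h0 h1 h2 e1 e2
    rw [← hc p q hpq u u1 u2 u12 (by rw [e1]; exact mul_ne_zero h0 h1)
      (by rw [e2]; exact mul_ne_zero h0 h2)]
    exact exists_common_factor_iff h0 h1 h2 e1 e2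

theorem compatYields_linear_iff {Λ : Type*} {s0 s1 s2 : Λ → ℂ} (h1 : ∀ p, s1 p ≠ 0)
    (h2 : ∀ p, s2 p ≠ 0) {E : Λ → Λ → QuadFn} :
    CompatYields (fun p u u1 U U1 => s0 p + s1 p * u + s2 p * u1 = U * U1) E ↔
      ∀ p q, p ≠ q → ∀ U U1 U2 U12,
        (linearEq (s0 p) (s1 p) (s2 p) (s0 q) (s1 q) (s2 q) U U1 U2 U12 = 0 ↔
          E p q U U1 U2 U12 = 0) := by
  constructor
  · intro hc p q hpq U U1 U2 U12
    -- The value `u` is free and has to avoid 0 and the two values for which `ũ = 0` or `û = 0`.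
    -- Hence the equivalence holds for all `U`, without exceptions.
    obtain ⟨u, hu⟩ := ((Set.finite_singleton (0 : ℂ)).insert ((U * U1 - s0 p) / s1 p) |>.insert
      ((U * U2 - s0 q) / s1 q)).infinite_compl.nonempty
    simp only [Set.mem_compl_iff, Set.mem_insert_iff, Set.mem_singleton_iff, not_or] at hu
    obtain ⟨hq, hp, h0⟩ := hu
    have e1 : s0 p + s1 p * u + s2 p * ((U * U1 - s0 p - s1 p * u) / s2 p) = U * U1 := by
      field_simp [h2 p]
      ring
    have e2 : s0 q + s1 q * u + s2 q * ((U * U2 - s0 q - s1 q * u) / s2 q) = U * U2 := by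
      field_simp [h2 q]
      ring
    rw [← hc p q hpq u _ _ U U1 U2 U12 h0 (div_ne_zero ?_ (h2 p)) (div_ne_zero ?_ (h2 q)) e1 e2]
    · exact (exists_common_value_iff (h2 p) (h2 q) e1 e2).symm
    · intro h
      apply hp
      rw [eq_div_iff (h1 p)]
      linear_combination -h
    · intro h
      apply hq
      rw [eq_div_iff (h1 q)]
      linear_combination -h
  · intro hc p q hpq u u1 u2 U U1 U2 U12 _ _ _ e1 e2
    rw [← hc p q hpq]
    exact exists_common_value_iff (h2 p) (h2 q) e1 e2

/-- Up to a nonzero factor, `E` is the same left-hand side as `H`. -/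
def IsNonzeroMultiple (E H : QuadFn) : Prop :=
  ∃ κ : ℂ, κ ≠ 0 ∧ ∀ u u1 u2 u12, E u u1 u2 u12 = κ * H u u1 u2 u12

theorem IsNonzeroMultiple.eq_zero_iff {E H : QuadFn} (h : IsNonzeroMultiple E H)
    (u u1 u2 u12 : ℂ) : H u u1 u2 u12 = 0 ↔ E u u1 u2 u12 = 0 := by
  obtain ⟨κ, hκ, h⟩ := h
  rw [h, mul_eq_zero_iff_left hκ]

theorem IsNonzeroMultiple.symm {E H : QuadFn} (h : IsNonzeroMultiple E H) :
    IsNonzeroMultiple H E := by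
  obtain ⟨κ, hκ, h⟩ := h
  exact ⟨κ⁻¹, inv_ne_zero hκ, fun u u1 u2 u12 => by rw [h, inv_mul_cancel_left₀ hκ]⟩

theorem IsNonzeroMultiple.trans {E H G : QuadFn} (h : IsNonzeroMultiple E H)
    (h' : IsNonzeroMultiple H G) : IsNonzeroMultiple E G := by
  obtain ⟨κ, hκ, h⟩ := h
  obtain ⟨μ, hμ, h'⟩ := h'
  exact ⟨κ * μ, mul_ne_zero hκ hμ, fun u u1 u2 u12 => by rw [h, h', mul_assoc]⟩

/-- The function `k` for which `s₀ + s₃ u ũ = U Ũ` is equivalent to `k(U, Ũ) = u ũ`. -/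
noncomputable def bilinearDual (s0 s3 : ℂ) : ℂ → ℂ → ℂ := fun U U1 => (U * U1 - s0) / s3

/-- A bilinear system keeps its form when `u` and `U` change roles, so results on compatibility in
`U` apply to both components. -/
theorem bilinear_edge_iff {s0 s3 : ℂ} (h3 : s3 ≠ 0) (u u1 U U1 : ℂ) :
    s0 + s3 * u * u1 = U * U1 ↔ bilinearDual s0 s3 U U1 = u * u1 := by
  rw [bilinearDual, div_eq_iff h3]
  constructor <;> intro h <;> linear_combination -h

theorem isConsistent_of_linear {Λ : Type*} {h : Λ → ℂ → ℂ → ℂ} {Q F : Λ → Λ → QuadFn}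
    (s0 s1 s2 : Λ → ℂ) (h1 : ∀ p, s1 p ≠ 0) (h2 : ∀ p, s2 p ≠ 0)
    (hh : ∀ p u u1, h p u u1 = s0 p + s1 p * u + s2 p * u1)
    (hQ : ∀ p q, IsNonzeroMultiple (Q p q) (productEq (h p) (h q)))
    (hF : ∀ p q, IsNonzeroMultiple (F p q)
      (linearEq (s0 p) (s1 p) (s2 p) (s0 q) (s1 q) (s2 q))) :
    (IsLinearForm h ∨ IsBilinearForm h) ∧ (Triplet.ofH h Q F).IsConsistent := by
  refine ⟨.inl ⟨s0, s1, s2, h1, h2, hh⟩, ?_, ?_⟩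
  · simp only [Triplet.ofH, hh]
    exact (compatYields_linear_iff h1 h2).2 fun p q _ => (hF p q).eq_zero_iff
  · exact compatYields_swap_iff.2 fun p q _ u u1 u2 u12 _ _ => (hQ p q).eq_zero_iff u u1 u2 u12

theorem isConsistent_of_bilinear {Λ : Type*} {h : Λ → ℂ → ℂ → ℂ} {Q F : Λ → Λ → QuadFn}
    (s0 s3 : Λ → ℂ) (h0 : ∀ p, s0 p ≠ 0) (h3 : ∀ p, s3 p ≠ 0)
    (hh : ∀ p u u1, h p u u1 = s0 p + s3 p * u * u1)
    (hQ : ∀ p q, IsNonzeroMultiple (Q p q) (productEq (h p) (h q)))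
    (hF : ∀ p q, IsNonzeroMultiple (F p q)
      (productEq (bilinearDual (s0 p) (s3 p)) (bilinearDual (s0 q) (s3 q)))) :
    (IsLinearForm h ∨ IsBilinearForm h) ∧ (Triplet.ofH h Q F).IsConsistent := by
  refine ⟨.inr ⟨s0, s3, h0, h3, hh⟩, ?_, ?_⟩
  · simp only [Triplet.ofH, hh, bilinear_edge_iff (h3 _)]
    exact compatYields_swap_iff.2 fun p q _ u u1 u2 u12 _ _ => (hF p q).eq_zero_iff u u1 u2 u12
  · exact compatYields_swap_iff.2 fun p q _ u u1 u2 u12 _ _ => (hQ p q).eq_zero_iff u u1 u2 u12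

/-! ### The six entries are consistent triplets -/

section Rows

variable (δ : ℂ) {p q σ τ : ℂ}

theorem multiple_no1_u (hp : p ≠ 0) (hq : q ≠ 0) : IsNonzeroMultiple (eqQ1 0 (p ^ 2) (q ^ 2))
    (productEq (fun u u1 => 1 / p * (u - u1)) fun u u1 => 1 / q * (u - u1)) :=
  ⟨-(p ^ 2 * q ^ 2), by simp [hp, hq], fun _ _ _ _ => by
    simp only [eqQ1, productEq]; field_simp; ring⟩

theorem multiple_no1_U (hp : p ≠ 0) (hq : q ≠ 0) : IsNonzeroMultiple (eqLpmKdV p q)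
    (linearEq 0 (1 / p) (-(1 / p)) 0 (1 / q) (-(1 / q))) :=
  ⟨p * q, by simp [hp, hq], fun _ _ _ _ => by simp only [eqLpmKdV, linearEq]; field_simp; ring⟩

variable (p q) in
theorem multiple_no2_u : IsNonzeroMultiple (eqH2 p q)
    (productEq (fun u u1 => u + u1 + p) fun u u1 => u + u1 + q) :=
  ⟨-1, by simp, fun _ _ _ _ => by simp only [eqH2, productEq]; ring⟩

variable (p q) in
theorem multiple_no2_U : IsNonzeroMultiple (eqH1 (2 * p) (2 * q)) (linearEq p 1 1 q 1 1) :=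
  ⟨1, by simp, fun _ _ _ _ => by simp only [eqH1, linearEq]; ring⟩

theorem multiple_no3_u (hp : p ≠ 0) (hq : q ≠ 0) : IsNonzeroMultiple (eqA1 δ (p ^ 2) (q ^ 2))
    (productEq (fun u u1 => 1 / p * (u + u1 - δ * p ^ 2))
      fun u u1 => 1 / q * (u + u1 - δ * q ^ 2)) :=
  ⟨-(p ^ 2 * q ^ 2), by simp [hp, hq], fun _ _ _ _ => by
    simp only [eqA1, productEq]; field_simp; ring⟩

theorem multiple_no3_U (hp : p ≠ 0) (hq : q ≠ 0) : IsNonzeroMultiple (eqH3 δ (2 * p) (2 * q))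
    (linearEq (-(δ * p)) (1 / p) (1 / p) (-(δ * q)) (1 / q) (1 / q)) :=
  ⟨2 * (p * q), by simp [hp, hq], fun _ _ _ _ => by
    simp only [eqH3, linearEq]; field_simp; ring⟩

variable {δ} (p q) in
theorem multiple_no4_u (hδ : δ ≠ 0) : IsNonzeroMultiple (eqH3 δ p q)
    (productEq (fun u u1 => u * u1 + δ * p) fun u u1 => u * u1 + δ * q) :=
  ⟨1 / δ, by simp [hδ], fun _ _ _ _ => by simp only [eqH3, productEq]; field_simp; ring⟩

variable {δ} (p q) in
theorem multiple_no4_U (hδ : δ ≠ 0) : IsNonzeroMultiple (eqH3 (-δ) p q)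
    (productEq (bilinearDual (δ * p) 1) (bilinearDual (δ * q) 1)) :=
  ⟨-(1 / δ), by simp [hδ], fun _ _ _ _ => by
    simp only [eqH3, productEq, bilinearDual]; field_simp; ring⟩

theorem multiple_no5_u (hp : p ≠ 0) (hq : q ≠ 0) : IsNonzeroMultiple (eqNew p q)
    (productEq (fun u u1 => 1 / p * (u * u1 - 1)) fun u u1 => 1 / q * (u * u1 - 1)) :=
  ⟨p ^ 2 * q ^ 2, by simp [hp, hq], fun _ _ _ _ => by
    simp only [eqNew, productEq]; field_simp⟩

theorem multiple_no5_U (hp : p ≠ 0) (hq : q ≠ 0) : IsNonzeroMultiple (eqH3Inv p q)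
    (productEq (bilinearDual (-(1 / p)) (1 / p)) (bilinearDual (-(1 / q)) (1 / q))) :=
  ⟨1, by simp, fun _ _ _ _ => by simp only [eqH3Inv, productEq, bilinearDual]; field_simp; ring⟩

theorem multiple_no6_u (hσ : σ ≠ 0) (hτ : τ ≠ 0) (hσp : σ ^ 2 = 1 - p ^ 2)
    (hτq : τ ^ 2 = 1 - q ^ 2) : IsNonzeroMultiple (eqA2 p q)
    (productEq (fun u u1 => 1 / σ * (1 - p * u * u1)) fun u u1 => 1 / τ * (1 - q * u * u1)) :=
  ⟨-(σ ^ 2 * τ ^ 2), by simp [hσ, hτ], fun _ _ _ _ => by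
    simp only [eqA2, productEq, ← hσp, ← hτq]
    field_simp
    rw [hσp, hτq]
    ring⟩

theorem multiple_no6_U (hσ : σ ≠ 0) (hτ : τ ≠ 0) (hp : p ≠ 0) (hq : q ≠ 0)
    (hσp : σ ^ 2 = 1 - p ^ 2) (hτq : τ ^ 2 = 1 - q ^ 2) : IsNonzeroMultiple (eqA2 σ τ)
    (productEq (bilinearDual (1 / σ) (-(p / σ))) (bilinearDual (1 / τ) (-(q / τ)))) :=
  ⟨-(p ^ 2 * q ^ 2), by simp [hp, hq], fun _ _ _ _ => by
    have h1 : 1 - σ ^ 2 = p ^ 2 := by rw [hσp]; ring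
    have h2 : 1 - τ ^ 2 = q ^ 2 := by rw [hτq]; ring
    simp only [eqA2, productEq, bilinearDual, h1, h2]
    field_simp
    rw [← h1, ← h2]
    ring⟩

end Rows

/-- A square has at most two roots. Two of the parameters may be opposite, but three distinct ones
never share their square, and this is all that the cube needs. -/
theorem not_sq_eq_sq_of_injective {Λ : Type*} {π : Λ → ℂ} (hπ : Function.Injective π)
    (p q r : Λ) (hpq : p ≠ q) (hpr : p ≠ r) (hqr : q ≠ r) :
    ¬(π p ^ 2 = π q ^ 2 ∧ π q ^ 2 = π r ^ 2) := by
  rintro ⟨h1, h2⟩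
  rcases sq_eq_sq_iff_eq_or_eq_neg.1 h1 with h1 | h1
  · exact hpq (hπ h1)
  · rcases sq_eq_sq_iff_eq_or_eq_neg.1 h2 with h2 | h2
    · exact hqr (hπ h2)
    · exact hpr (hπ (by rw [h1, h2, neg_neg]))

/-- Every entry of the list is a consistent triplet of equations that are consistent around the cube
and have the tetrahedron property. -/
theorem TableRow.isConsistent {Λ : Type*} {π : Λ → ℂ} {h : Λ → ℂ → ℂ → ℂ} {Q F : Λ → Λ → QuadFn}
    (hπ : Function.Injective π) (hrow : TableRow π h Q F) :
    ((IsLinearForm h ∨ IsBilinearForm h) ∧ (Triplet.ofH h Q F).IsConsistent) ∧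
      ((∀ p q, IsAffineLinear (Q p q)) ∧ ∀ p q, IsAffineLinear (F p q)) ∧
      (ConsistentAroundCube Q ∧ TetrahedronProperty Q) ∧
      (ConsistentAroundCube F ∧ TetrahedronProperty F) := by
  have hsq := not_sq_eq_sq_of_injective hπ
  have hsq2 := not_sq_eq_sq_of_injective (π := fun p => 2 * π p)
    fun p q h => hπ (mul_left_cancel₀ two_ne_zero h)
  cases hrow with
  | no1 h0 =>
    refine ⟨isConsistent_of_linear (fun _ => 0) (fun p => 1 / π p) (fun p => -(1 / π p))
      (by simp [h0]) (by simp [h0]) (fun p u u1 => by ring)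
      (fun p q => multiple_no1_u (h0 p) (h0 q)) fun p q => multiple_no1_U (h0 p) (h0 q),
      ⟨fun p q => ?_, fun p q => ?_⟩,
      consistentAroundCube_eqQ1 (P := fun p => π p ^ 2) (fun p => pow_ne_zero 2 (h0 p)) hsq,
      consistentAroundCube_eqLpmKdV h0 hsq⟩
    · apply isAffineLinear_of_affine <;> intros <;> simp only [eqQ1] <;> ring
    · apply isAffineLinear_of_affine <;> intros <;> simp only [eqLpmKdV] <;> ring
  | no2 =>
    refine ⟨isConsistent_of_linear π (fun _ => 1) (fun _ => 1) (by simp) (by simp)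
      (fun p u u1 => by ring) (fun p q => multiple_no2_u _ _) fun p q => multiple_no2_U _ _,
      ⟨fun p q => ?_, fun p q => ?_⟩, consistentAroundCube_eqH2 hπ,
      consistentAroundCube_eqH1 (P := fun p => 2 * π p)
        fun p q h => hπ (mul_left_cancel₀ two_ne_zero h)⟩
    · apply isAffineLinear_of_affine <;> intros <;> simp only [eqH2] <;> ring
    · apply isAffineLinear_of_affine <;> intros <;> simp only [eqH1] <;> ring
  | no3 δ h0 =>
    refine ⟨isConsistent_of_linear (fun p => -(δ * π p)) (fun p => 1 / π p) (fun p => 1 / π p)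
      (by simp [h0]) (by simp [h0]) (fun p u u1 => by have := h0 p; field_simp; ring)
      (fun p q => multiple_no3_u δ (h0 p) (h0 q)) fun p q => multiple_no3_U δ (h0 p) (h0 q),
      ⟨fun p q => ?_, fun p q => ?_⟩,
      consistentAroundCube_eqA1 δ (P := fun p => π p ^ 2) (fun p => pow_ne_zero 2 (h0 p)) hsq,
      consistentAroundCube_eqH3 δ (P := fun p => 2 * π p)
        (fun p => mul_ne_zero two_ne_zero (h0 p)) hsq2⟩
    · apply isAffineLinear_of_affine <;> intros <;> simp only [eqA1] <;> ring
    · apply isAffineLinear_of_affine <;> intros <;> simp only [eqH3] <;> ring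
  | no4 δ hδ h0 =>
    refine ⟨isConsistent_of_bilinear (fun p => δ * π p) (fun _ => 1) (by simp [h0, hδ]) (by simp)
      (fun p u u1 => by ring) (fun p q => multiple_no4_u _ _ hδ) fun p q => multiple_no4_U _ _ hδ,
      ⟨fun p q => ?_, fun p q => ?_⟩, consistentAroundCube_eqH3 δ h0 hsq,
      consistentAroundCube_eqH3 (-δ) h0 hsq⟩
    all_goals apply isAffineLinear_of_affine <;> intros <;> simp only [eqH3] <;> ring
  | no5 h0 =>
    refine ⟨isConsistent_of_bilinear (fun p => -(1 / π p)) (fun p => 1 / π p) (by simp [h0])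
      (by simp [h0]) (fun p u u1 => by ring) (fun p q => multiple_no5_u (h0 p) (h0 q))
      fun p q => multiple_no5_U (h0 p) (h0 q),
      ⟨fun p q => ?_, fun p q => ?_⟩, consistentAroundCube_eqNew h0 hsq,
      consistentAroundCube_eqH3Inv h0 hsq⟩
    · apply isAffineLinear_of_affine <;> intros <;> simp only [eqNew] <;> ring
    · apply isAffineLinear_of_affine <;> intros <;> simp only [eqH3Inv] <;> ring
  | no6 σ h0 hσ hσπ =>
    refine ⟨isConsistent_of_bilinear (fun p => 1 / σ p) (fun p => -(π p / σ p)) (by simp [hσ])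
      (by simp [h0, hσ]) (fun p u u1 => by ring)
      (fun p q => multiple_no6_u (hσ p) (hσ q) (hσπ p) (hσπ q))
      fun p q => multiple_no6_U (hσ p) (hσ q) (h0 p) (h0 q) (hσπ p) (hσπ q),
      ⟨fun p q => ?_, fun p q => ?_⟩,
      consistentAroundCube_eqA2 h0 (fun p => by simp [← hσπ, hσ]) hsq,
      consistentAroundCube_eqA2 hσ (fun p => by simp [hσπ, h0])
        fun p q r h1 h2 h3 h => hsq p q r h1 h2 h3 (by simpa [hσπ] using h)⟩
    all_goals apply isAffineLinear_of_affine <;> intros <;> simp only [eqA2] <;> ring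

/-! ### Necessary conditions on the coefficients -/

theorem isAffineLinear_linearEq (a0 a1 a2 b0 b1 b2 : ℂ) :
    IsAffineLinear (linearEq a0 a1 a2 b0 b1 b2) := by
  apply isAffineLinear_of_affine <;> intros <;> simp only [linearEq] <;> ring

/-- A multi-affine polynomial with the same zeros as `linearEq` is a multiple of it. -/
theorem isNonzeroMultiple_linearEq {a0 a1 a2 b0 b1 b2 : ℂ} (ha1 : a1 ≠ 0) (ha2 : a2 ≠ 0)
    (hb1 : b1 ≠ 0) {E : QuadFn} (hE : IsAffineLinear E)
    (hz : ∀ u u1 u2 u12, linearEq a0 a1 a2 b0 b1 b2 u u1 u2 u12 = 0 ↔ E u u1 u2 u12 = 0) :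
    IsNonzeroMultiple E (linearEq a0 a1 a2 b0 b1 b2) := by
  have hH := isAffineLinear_linearEq a0 a1 a2 b0 b1 b2
  obtain ⟨e0, e1, e2, e3⟩ := hE.affine
  obtain ⟨k0, k1, k2, k3⟩ := hH.affine
  have ⟨c, hc⟩ := hE
  -- The slopes of `linearEq` in its four variables. The zeros agree everywhere, so no resultants
  -- are needed here.
  have d0 : Generically fun x => b1 * x 1 - a1 * x 2 ≠ 0 :=
    .ne_zero (by fun_prop) ⟨![0, 1, 0, 0], by simpa using hb1⟩
  have d1 : Generically fun x => b1 * x 0 - a2 * x 3 ≠ 0 :=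
    .ne_zero (by fun_prop) ⟨![1, 0, 0, 0], by simpa using hb1⟩
  have d2 : Generically fun x => b2 * x 3 - a1 * x 0 ≠ 0 :=
    .ne_zero (by fun_prop) ⟨![1, 0, 0, 0], by simpa using ha1⟩
  have d3 : Generically fun x => b2 * x 2 - a2 * x 1 ≠ 0 :=
    .ne_zero (by fun_prop) ⟨![0, 1, 0, 0], by simpa using ha2⟩
  have hne : ∃ u u1 u2 u12, linearEq a0 a1 a2 b0 b1 b2 u u1 u2 u12 ≠ 0 := by
    by_contra! h
    have h1 := h 1 1 0 0
    have h2 := h 0 0 0 0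
    simp only [linearEq] at h1 h2
    apply hb1
    linear_combination h1 - h2
  obtain ⟨κ, hκ⟩ : ∃ κ, ∀ u u1 u2 u12, E u u1 u2 u12 =
      κ * linearEq a0 a1 a2 b0 b1 b2 u u1 u2 u12 := by
    refine exists_proportional_of_lines hE.isPolynomialFun hH.isPolynomialFun hne ?_ ?_ ?_ ?_
    · intro s t u1 u2 u12
      refine affine_cross_eq (e := fun s => E s u1 u2 u12)
        (h := fun s => linearEq a0 a1 a2 b0 b1 b2 s u1 u2 u12) (fun _ => e0 _ _ _ _)
        (fun _ => k0 _ _ _ _) ?_ s t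
      refine Generically.eq_zero (f := fun x => E 0 (x 1) (x 2) (x 3) *
        linearEq a0 a1 a2 b0 b1 b2 1 (x 1) (x 2) (x 3) - E 1 (x 1) (x 2) (x 3) *
        linearEq a0 a1 a2 b0 b1 b2 0 (x 1) (x 2) (x 3)) ?_ ?_ ![0, u1, u2, u12]
      · simp only [hc, linearEq, Fin.sum_univ_two]
        fun_prop
      · refine d0.mono fun x hx => ?_
        refine affine_cross_eq_zero (e := fun s => E s _ _ _)
          (h := fun s => linearEq a0 a1 a2 b0 b1 b2 s _ _ _) (fun _ => e0 _ _ _ _)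
          (fun _ => k0 _ _ _ _) ?_ fun t => (hz _ _ _ _).1
        convert hx using 1
        simp only [linearEq]
        ring
    · intro u s t u2 u12
      refine affine_cross_eq (e := fun s => E u s u2 u12)
        (h := fun s => linearEq a0 a1 a2 b0 b1 b2 u s u2 u12) (fun _ => e1 _ _ _ _)
        (fun _ => k1 _ _ _ _) ?_ s t
      refine Generically.eq_zero (f := fun x => E (x 0) 0 (x 2) (x 3) *
        linearEq a0 a1 a2 b0 b1 b2 (x 0) 1 (x 2) (x 3) - E (x 0) 1 (x 2) (x 3) *
        linearEq a0 a1 a2 b0 b1 b2 (x 0) 0 (x 2) (x 3)) ?_ ?_ ![u, 0, u2, u12]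
      · simp only [hc, linearEq, Fin.sum_univ_two]
        fun_prop
      · refine d1.mono fun x hx => ?_
        refine affine_cross_eq_zero (e := fun s => E _ s _ _)
          (h := fun s => linearEq a0 a1 a2 b0 b1 b2 _ s _ _) (fun _ => e1 _ _ _ _)
          (fun _ => k1 _ _ _ _) ?_ fun t => (hz _ _ _ _).1
        convert hx using 1
        simp only [linearEq]
        ring
    · intro u u1 s t u12
      refine affine_cross_eq (e := fun s => E u u1 s u12)
        (h := fun s => linearEq a0 a1 a2 b0 b1 b2 u u1 s u12) (fun _ => e2 _ _ _ _)
        (fun _ => k2 _ _ _ _) ?_ s t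
      refine Generically.eq_zero (f := fun x => E (x 0) (x 1) 0 (x 3) *
        linearEq a0 a1 a2 b0 b1 b2 (x 0) (x 1) 1 (x 3) - E (x 0) (x 1) 1 (x 3) *
        linearEq a0 a1 a2 b0 b1 b2 (x 0) (x 1) 0 (x 3)) ?_ ?_ ![u, u1, 0, u12]
      · simp only [hc, linearEq, Fin.sum_univ_two]
        fun_prop
      · refine d2.mono fun x hx => ?_
        refine affine_cross_eq_zero (e := fun s => E _ _ s _)
          (h := fun s => linearEq a0 a1 a2 b0 b1 b2 _ _ s _) (fun _ => e2 _ _ _ _)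
          (fun _ => k2 _ _ _ _) ?_ fun t => (hz _ _ _ _).1
        convert hx using 1
        simp only [linearEq]
        ring
    · intro u u1 u2 s t
      refine affine_cross_eq (e := fun s => E u u1 u2 s)
        (h := fun s => linearEq a0 a1 a2 b0 b1 b2 u u1 u2 s) (fun _ => e3 _ _ _ _)
        (fun _ => k3 _ _ _ _) ?_ s t
      refine Generically.eq_zero (f := fun x => E (x 0) (x 1) (x 2) 0 *
        linearEq a0 a1 a2 b0 b1 b2 (x 0) (x 1) (x 2) 1 - E (x 0) (x 1) (x 2) 1 *
        linearEq a0 a1 a2 b0 b1 b2 (x 0) (x 1) (x 2) 0) ?_ ?_ ![u, u1, u2, 0]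
      · simp only [hc, linearEq, Fin.sum_univ_two]
        fun_prop
      · refine d3.mono fun x hx => ?_
        refine affine_cross_eq_zero (e := fun s => E _ _ _ s)
          (h := fun s => linearEq a0 a1 a2 b0 b1 b2 _ _ _ s) (fun _ => e3 _ _ _ _)
          (fun _ => k3 _ _ _ _) ?_ fun t => (hz _ _ _ _).1
        convert hx using 1
        simp only [linearEq]
        ring
  refine ⟨κ, ?_, hκ⟩
  rintro rfl
  obtain ⟨u, u1, u2, u12, h⟩ := hne
  exact h ((hz _ _ _ _).2 (by rw [hκ, zero_mul]))

theorem ConsistentAroundCube.of_multiple {Λ : Type*} {Q R : Λ → Λ → QuadFn}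
    (hQ : ConsistentAroundCube Q) (h : ∀ p q, p ≠ q → IsNonzeroMultiple (Q p q) (R p q)) :
    ConsistentAroundCube R := by
  intro p q r hpq hpr hqr
  obtain ⟨D, hD, hDv⟩ := hQ p q r hpq hpr hqr
  refine ⟨D, hD, fun u u1 u2 u3 hx => ?_⟩
  obtain ⟨v, u12, u13, u23, h1⟩ := hDv u u1 u2 u3 hx
  refine ⟨v, u12, u13, u23, ?_⟩
  simpa only [(h p q hpq).eq_zero_iff, (h p r hpr).eq_zero_iff, (h q r hqr).eq_zero_iff] using h1

/-- With `a = 0`, one root would make every number a root. Unique solvability on the cube thus says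
that the leading coefficients do not vanish. -/
theorem unique_root {a b v : ℂ} {f : ℂ → ℂ} (hf : ∀ x, f x = a * x + b)
    (h : ∀ x, f x = 0 ↔ x = v) : a ≠ 0 ∧ a * v + b = 0 := by
  have hv : a * v + b = 0 := (hf v).symm.trans ((h v).2 rfl)
  refine ⟨?_, hv⟩
  rintro rfl
  have := (h (v + 1)).1 (by rw [hf]; linear_combination hv)
  simp at this

/-- What consistency around the cube says about `linearEq`. -/
theorem linearEq_cube_conditions {Λ : Type*} {s0 s1 s2 : Λ → ℂ} (h1 : ∀ p, s1 p ≠ 0)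
    (h2 : ∀ p, s2 p ≠ 0)
    (hc : ConsistentAroundCube fun p q => linearEq (s0 p) (s1 p) (s2 p) (s0 q) (s1 q) (s2 q))
    {C : Λ → Λ → ℂ} (hC : ∀ p q, C p q = s0 q * (s1 p + s2 p) - s0 p * (s1 q + s2 q))
    {p q r : Λ} (hpq : p ≠ q) (hpr : p ≠ r) (hqr : q ≠ r) :
    (C p q ≠ 0 → s2 p * s2 q * C p q = s1 r * (s2 p * C p r - s2 q * C q r) ∧
      s1 q * C p r - s1 p * C q r = s2 r * C p q) ∧
    (C p r = 0 → C q r = 0 → s1 p * s2 p = s1 r * s2 r → s1 q * s2 q ≠ s1 r * s2 r) := by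
  have hgen := (generically_iff _).1 (hc p q r hpq hpr hqr)
  have hA : ∀ p q u u1 u2 x, linearEq (s0 p) (s1 p) (s2 p) (s0 q) (s1 q) (s2 q) u u1 u2 x =
      (s2 q * u2 - s2 p * u1) * x + -(s1 p * u * u2 - s1 q * u * u1 - C p q) := by
    intro p q u u1 u2 x
    rw [hC]
    simp only [linearEq]
    ring
  -- With denominators cleared: the leading coefficient on the face at `u3` is nonzero, and the
  -- values from the faces at `u3` and `u2` agree after cross-multiplication.
  have key : Generically fun x =>
      s2 q * (s1 q * x 0 * x 3 - s1 r * x 0 * x 2 - C q r) * (s2 r * x 3 - s2 p * x 1) -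
        s2 p * (s1 p * x 0 * x 3 - s1 r * x 0 * x 1 - C p r) * (s2 r * x 3 - s2 q * x 2) ≠ 0 ∧
      (s1 q * x 3 * (s1 p * x 0 * x 3 - s1 r * x 0 * x 1 - C p r) * (s2 r * x 3 - s2 q * x 2) -
        s1 p * x 3 * (s1 q * x 0 * x 3 - s1 r * x 0 * x 2 - C q r) * (s2 r * x 3 - s2 p * x 1) +
        C p q * (s2 r * x 3 - s2 p * x 1) * (s2 r * x 3 - s2 q * x 2)) *
      (s2 r * (s1 q * x 0 * x 3 - s1 r * x 0 * x 2 - C q r) * (s2 q * x 2 - s2 p * x 1) -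
        s2 p * (s1 p * x 0 * x 2 - s1 q * x 0 * x 1 - C p q) * (s2 r * x 3 - s2 q * x 2)) -
      (s1 r * x 2 * (s1 p * x 0 * x 2 - s1 q * x 0 * x 1 - C p q) * (s2 r * x 3 - s2 q * x 2) -
        s1 p * x 2 * (s1 q * x 0 * x 3 - s1 r * x 0 * x 2 - C q r) * (s2 q * x 2 - s2 p * x 1) +
        C p r * (s2 q * x 2 - s2 p * x 1) * (s2 r * x 3 - s2 q * x 2)) *
      (s2 q * (s1 q * x 0 * x 3 - s1 r * x 0 * x 2 - C q r) * (s2 r * x 3 - s2 p * x 1) -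
        s2 p * (s1 p * x 0 * x 3 - s1 r * x 0 * x 1 - C p r) * (s2 r * x 3 - s2 q * x 2)) = 0 := by
    refine hgen.mono fun x hx => ?_
    obtain ⟨v, u12, u13, u23, e12, e13, e23, f3, f2, -⟩ := hx
    generalize x 0 = u, x 1 = u1, x 2 = u2, x 3 = u3 at *
    obtain ⟨d12, e12⟩ := unique_root (hA p q u u1 u2) e12
    obtain ⟨d13, e13⟩ := unique_root (hA p r u u1 u3) e13
    obtain ⟨d23, e23⟩ := unique_root (hA q r u u2 u3) e23
    obtain ⟨a3, f3⟩ := unique_root (hA p q u3 u13 u23) f3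
    obtain ⟨-, f2⟩ := unique_root (hA p r u2 u12 u23) f2
    generalize hd12 : s2 q * u2 - s2 p * u1 = D12 at *
    generalize hd13 : s2 r * u3 - s2 p * u1 = D13 at *
    generalize hd23 : s2 r * u3 - s2 q * u2 = D23 at *
    have n12 : s1 p * u * u2 - s1 q * u * u1 - C p q = D12 * u12 := by linear_combination -e12
    have n13 : s1 p * u * u3 - s1 r * u * u1 - C p r = D13 * u13 := by linear_combination -e13
    have n23 : s1 q * u * u3 - s1 r * u * u2 - C q r = D23 * u23 := by linear_combination -e23
    rw [n12, n13, n23]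
    have hM : s2 q * (D23 * u23) * D13 - s2 p * (D13 * u13) * D23 =
        D13 * D23 * (s2 q * u23 - s2 p * u13) := by ring
    refine ⟨by rw [hM]; exact mul_ne_zero (mul_ne_zero d13 d23) a3, ?_⟩
    linear_combination D13 * D23 ^ 2 * D12 * (s2 r * u23 - s2 p * u12) * f3
      - D13 * D23 ^ 2 * D12 * (s2 q * u23 - s2 p * u13) * f2
  constructor
  · intro hne
    have h0 := (key.mono fun x hx => hx.2).eq_zero (by fun_prop)
    -- At both points `u = 0` and `s2 q * u2 = s2 p * u1`. The `p, q` face at `u` then has leading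
    -- coefficient 0 and numerator `-C p q`, which becomes a common factor of the identity.
    have ha := h0 ![0, s2 q * s2 r, s2 p * s2 r, 0]
    have hb := h0 ![0, 0, 0, s2 p * s2 q]
    simp only [Matrix.cons_val] at ha hb
    have hp := h2 p
    have hq := h2 q
    have hr := h2 r
    constructor
    · apply mul_left_cancel₀ (mul_ne_zero (mul_ne_zero (pow_ne_zero 3 hp) (pow_ne_zero 2 hq))
        (mul_ne_zero (pow_ne_zero 3 hr) hne))
      linear_combination -ha
    · apply mul_left_cancel₀ (mul_ne_zero (mul_ne_zero (pow_ne_zero 4 hp) (pow_ne_zero 3 hq))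
        (mul_ne_zero (pow_ne_zero 2 hr) hne))
      linear_combination -hb
  -- Equality in the conclusion would make the leading coefficient on the face at `u3` vanish
  -- identically.
  · intro hpr0 hqr0 tp tq
    obtain ⟨x, hx, -⟩ := key.exists_of
    apply hx
    rw [hpr0, hqr0]
    linear_combination x 0 * x 3 * (s2 r * x 3 * (tq - tp) - s2 p * x 1 * tq + s2 q * x 2 * tp)

/-- What consistency around the cube says about `productEq` in the bilinear case. -/
theorem bilinear_cube_condition {Λ : Type*} {h : Λ → ℂ → ℂ → ℂ} {s0 s3 : Λ → ℂ}
    (h0 : ∀ p, s0 p ≠ 0) (h3 : ∀ p, s3 p ≠ 0)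
    (hh : ∀ p u u1, h p u u1 = s0 p + s3 p * u * u1)
    (hc : ConsistentAroundCube fun p q => productEq (h p) (h q))
    {p q r : Λ} (hpq : p ≠ q) (hpr : p ≠ r) (hqr : q ≠ r) :
    (s0 p ^ 2 - s0 r ^ 2) * (s3 q ^ 2 - s3 r ^ 2) =
      (s0 q ^ 2 - s0 r ^ 2) * (s3 p ^ 2 - s3 r ^ 2) := by
  have hgen := (generically_iff _).1 (hc p q r hpq hpr hqr)
  let d : Λ → Λ → ℂ → ℂ → ℂ → ℂ := fun p q u u1 u2 => s0 p * s3 p * u2 - s0 q * s3 q * u1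
    + (s3 p ^ 2 - s3 q ^ 2) * u * u1 * u2
  let n : Λ → Λ → ℂ → ℂ → ℂ → ℂ := fun p q u u1 u2 => s0 q ^ 2 - s0 p ^ 2
    - s0 p * s3 p * u * u1 + s0 q * s3 q * u * u2
  have hA : ∀ p q u u1 u2 x, productEq (h p) (h q) u u1 u2 x = d p q u u1 u2 * x + -n p q u u1 u2 := by
    intro p q u u1 u2 x
    simp only [productEq, hh, d, n]
    ring
  -- Equality of the values from the faces at `u3` and `u2`, cross-multiplied and cleared of
  -- denominators.
  have key : Generically fun x =>
      ((s0 p ^ 2 - s0 q ^ 2) * d p r (x 0) (x 1) (x 3) * d q r (x 0) (x 2) (x 3) +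
        s0 p * s3 p * x 3 * n p r (x 0) (x 1) (x 3) * d q r (x 0) (x 2) (x 3) -
        s0 q * s3 q * x 3 * n q r (x 0) (x 2) (x 3) * d p r (x 0) (x 1) (x 3)) *
      (s0 p * s3 p * n q r (x 0) (x 2) (x 3) * d p q (x 0) (x 1) (x 2) -
        s0 r * s3 r * n p q (x 0) (x 1) (x 2) * d q r (x 0) (x 2) (x 3) +
        (s3 p ^ 2 - s3 r ^ 2) * x 2 * n p q (x 0) (x 1) (x 2) * n q r (x 0) (x 2) (x 3)) -
      ((s0 p ^ 2 - s0 r ^ 2) * d p q (x 0) (x 1) (x 2) * d q r (x 0) (x 2) (x 3) +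
        s0 p * s3 p * x 2 * n p q (x 0) (x 1) (x 2) * d q r (x 0) (x 2) (x 3) -
        s0 r * s3 r * x 2 * n q r (x 0) (x 2) (x 3) * d p q (x 0) (x 1) (x 2)) *
      (s0 p * s3 p * n q r (x 0) (x 2) (x 3) * d p r (x 0) (x 1) (x 3) -
        s0 q * s3 q * n p r (x 0) (x 1) (x 3) * d q r (x 0) (x 2) (x 3) +
        (s3 p ^ 2 - s3 q ^ 2) * x 3 * n p r (x 0) (x 1) (x 3) * n q r (x 0) (x 2) (x 3)) = 0 := by
    refine hgen.mono fun x hx => ?_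
    obtain ⟨v, u12, u13, u23, e12, e13, e23, f3, f2, -⟩ := hx
    generalize x 0 = u, x 1 = u1, x 2 = u2, x 3 = u3 at *
    have n12 : n p q u u1 u2 = d p q u u1 u2 * u12 := by
      linear_combination -(unique_root (hA p q u u1 u2) e12).2
    have n13 : n p r u u1 u3 = d p r u u1 u3 * u13 := by
      linear_combination -(unique_root (hA p r u u1 u3) e13).2
    have n23 : n q r u u2 u3 = d q r u u2 u3 * u23 := by
      linear_combination -(unique_root (hA q r u u2 u3) e23).2
    have f3 := (unique_root (hA p q u3 u13 u23) f3).2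
    have f2 := (unique_root (hA p r u2 u12 u23) f2).2
    rw [n12, n13, n23]
    generalize d p q u u1 u2 = D12, d p r u u1 u3 = D13, d q r u u2 u3 = D23
    simp only [d, n] at f3 f2
    linear_combination D13 * D23 ^ 2 * D12 * (s0 p * s3 p * u23 - s0 r * s3 r * u12
      + (s3 p ^ 2 - s3 r ^ 2) * u2 * u12 * u23) * f3 - D13 * D23 ^ 2 * D12 *
      (s0 p * s3 p * u23 - s0 q * s3 q * u13 + (s3 p ^ 2 - s3 q ^ 2) * u3 * u13 * u23) * f2
  have hz := key.eq_zero (by simp only [d, n]; fun_prop)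
  -- At `u = u1 = 0` the identity contains the collinearity determinant times a linear form in `u2,
  -- u3`; the factor 2 keeps that form from vanishing. At the second point the `p, r` face at `u`
  -- has leading coefficient 0.
  have ha := hz ![0, 0, s0 q * s3 q * s0 r ^ 2, s0 r * s3 r * 2 * s0 q ^ 2]
  have hb := hz ![0, s0 p * s3 p, 0, s0 r * s3 r]
  simp only [Matrix.cons_val, d, n] at ha hb
  have k : ∀ p, s0 p * s3 p ≠ 0 := fun p => mul_ne_zero (h0 p) (h3 p)
  -- The first evaluation carries the factor `s0 q ^ 2 - s0 r ^ 2`, the second `s0 p ^ 2 - s0 r ^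
  -- 2`. If both are zero, the claim is trivial.
  by_cases hqr' : s0 q ^ 2 = s0 r ^ 2
  · by_cases hpr' : s0 p ^ 2 = s0 r ^ 2
    · rw [hqr', hpr']
      ring
    · apply mul_left_cancel₀ (mul_ne_zero (mul_ne_zero (mul_ne_zero (k p) (pow_ne_zero 2 (k q)))
        (pow_ne_zero 2 (k r))) (mul_ne_zero (sub_ne_zero.2 hpr') (pow_ne_zero 2 (h0 r))))
      linear_combination hb
  · apply mul_left_cancel₀ (mul_ne_zero (mul_ne_zero (mul_ne_zero (k p) (pow_ne_zero 2 (k q)))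
      (pow_ne_zero 2 (k r))) (mul_ne_zero (sub_ne_zero.2 hqr')
      (mul_ne_zero (pow_ne_zero 4 (h0 r)) (pow_ne_zero 4 (h0 q)))))
    linear_combination -ha / 2

/-- Consistency around the cube of `linearEq` for infinitely many parameters: either all constant
terms vanish, or `s₁ = s₂`, and `s₁²` is constant or `s₀` is a combination of `s₁` and `1 / s₁`. -/
theorem linear_classification {Λ : Type*} [Infinite Λ] {s0 s1 s2 : Λ → ℂ} (h1 : ∀ p, s1 p ≠ 0)
    (h2 : ∀ p, s2 p ≠ 0)
    (hc : ConsistentAroundCube fun p q => linearEq (s0 p) (s1 p) (s2 p) (s0 q) (s1 q) (s2 q)) :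
    (∀ p q, s0 q * (s1 p + s2 p) = s0 p * (s1 q + s2 q)) ∨
      ((∀ p, s2 p = s1 p) ∧ ((∀ p q, s1 p ^ 2 = s1 q ^ 2) ∨
        ∃ k μ, ∀ p, s0 p = k * s1 p + μ / s1 p)) := by
  refine or_iff_not_imp_left.2 fun hcon => ?_
  push Not at hcon
  obtain ⟨p, q, hne⟩ := hcon
  let C : Λ → Λ → ℂ := fun p q => s0 q * (s1 p + s2 p) - s0 p * (s1 q + s2 q)
  have hC : ∀ p q, C p q = s0 q * (s1 p + s2 p) - s0 p * (s1 q + s2 q) := fun _ _ => rfl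
  have hsymm : ∀ p q, C q p = -C p q := fun p q => by rw [hC, hC]; ring
  -- `C` is the determinant of the vectors `(s0, s1 + s2)`; any three vectors in the plane satisfy
  -- this linear relation.
  have hplucker : ∀ p q r, C p q * (s1 r + s2 r) + C q r * (s1 p + s2 p)
      + C r p * (s1 q + s2 q) = 0 := fun p q r => by simp only [hC]; ring
  have cond := fun {p q r : Λ} => linearEq_cube_conditions h1 h2 hc hC (p := p) (q := q) (r := r)
  clear_value C
  have hCpq : C p q ≠ 0 := by rw [hC]; exact sub_ne_zero.2 hne
  have hpq : p ≠ q := by rintro rfl; exact hne rfl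
  -- the second relation without the constant term of the first pair
  have rel : ∀ {p q r : Λ}, p ≠ q → p ≠ r → q ≠ r → C p q ≠ 0 →
      (s1 q * s2 q - s1 r * s2 r) * (s2 p * C p r) = (s1 p * s2 p - s1 r * s2 r) *
        (s2 q * C q r) := by
    intro p q r hpq hpr hqr h
    obtain ⟨c1, c2⟩ := (cond hpq hpr hqr).1 h
    linear_combination s2 r * c1 + s2 p * s2 q * c2
  -- a pair without constant term consists of a direction and its reverse
  have pair : ∀ {p q r : Λ}, p ≠ q → p ≠ r → q ≠ r → C p q ≠ 0 → C q r = 0 →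
      C p r ≠ 0 ∧ s1 q * s1 r = s2 q * s2 r ∧ s1 q * s2 q = s1 r * s2 r := by
    intro p q r hpq hpr hqr h h0
    have hr : C p r ≠ 0 := by
      intro hr
      obtain ⟨c1, -⟩ := (cond hpq hpr hqr).1 h
      rw [hr, h0, mul_zero, mul_zero, sub_zero, mul_zero] at c1
      exact mul_ne_zero (mul_ne_zero (h2 p) (h2 q)) h c1
    obtain ⟨c1, -⟩ := (cond hpq hpr hqr).1 h
    obtain ⟨d1, -⟩ := (cond hpr hpq hqr.symm).1 hr
    have e := rel hpq hpr hqr h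
    rw [hsymm q r] at d1
    rw [h0] at c1 d1 e
    refine ⟨hr, ?_, ?_⟩
    · apply mul_left_cancel₀ (mul_ne_zero (h2 p) h)
      linear_combination -s2 r * c1 - s1 r * d1
    · have := mul_ne_zero (h2 p) hr
      rw [mul_zero, mul_zero] at e
      exact sub_eq_zero.1 ((mul_eq_zero.1 e).resolve_right this)
  -- If `s1 * s2` differs at `p` and `r`, two instances of `rel` suffice. Otherwise it agrees at all
  -- three directions, and the relation follows from `hplucker` and the second cube condition.
  have sum_zero : ∀ {p q r : Λ}, p ≠ q → p ≠ r → q ≠ r → C p q ≠ 0 → C p r ≠ 0 → C q r ≠ 0 →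
      s2 p * s2 q * C p q - s2 p * s2 r * C p r + s2 q * s2 r * C q r = 0 := by
    intro p q r hpq hpr hqr hCpq hCpr hCqr
    have e1 := rel hpq hpr hqr hCpq
    have e2 := rel hqr hpq.symm hpr.symm hCqr
    rw [hsymm p q, hsymm p r] at e2
    by_cases ht : s1 p * s2 p = s1 r * s2 r
    · rw [ht, sub_self, zero_mul] at e1
      have ht' := sub_eq_zero.1 ((mul_eq_zero.1 e1).resolve_right (mul_ne_zero (h2 p) hCpr))
      obtain ⟨-, ca⟩ := (cond hpq hpr hqr).1 hCpq
      obtain ⟨-, cb⟩ := (cond hqr hpq.symm hpr.symm).1 hCqr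
      obtain ⟨-, cc⟩ := (cond hpr hpq hqr.symm).1 hCpr
      rw [hsymm p q, hsymm p r] at cb
      rw [hsymm q r] at cc
      have pl := hplucker p q r
      rw [hsymm p r] at pl
      apply mul_left_cancel₀ (mul_ne_zero (h1 r) (h2 r))
      linear_combination -s2 p * s2 q * s2 r * (pl + ca + cb - cc)
        + s2 r * s2 p * C p r * ht' - s2 r * s2 q * C q r * ht
    · apply mul_left_cancel₀ (sub_ne_zero.2 ht)
      linear_combination s2 p * e2 - s2 r * e1
  -- The first cube condition and `sum_zero` express `s2 p * s2 q * C p q` as `s1 r` and as `s2 r`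
  -- times the same bracket.
  have eq_of_ne : ∀ {p q r : Λ}, p ≠ q → p ≠ r → q ≠ r → C p q ≠ 0 → C p r ≠ 0 → C q r ≠ 0 →
      s2 r = s1 r := by
    intro p q r hpq hpr hqr hCpq hCpr hCqr
    apply mul_left_cancel₀ (mul_ne_zero (mul_ne_zero (h2 p) (h2 q)) hCpq)
    linear_combination s2 r * ((cond hpq hpr hqr).1 hCpq).1
      - s1 r * sum_zero hpq hpr hqr hCpq hCpr hCqr
  -- a direction has at most one reverse
  have subsing : ∀ {p q : Λ}, p ≠ q → C p q ≠ 0 →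
      {r | r ≠ p ∧ r ≠ q ∧ C q r = 0}.Subsingleton := by
    rintro p q hpq h r ⟨hrp, hrq, hr⟩ r' ⟨hrp', hrq', hr'⟩
    by_contra hrr
    obtain ⟨-, -, t1⟩ := pair hpq hrp.symm hrq.symm h hr
    obtain ⟨-, -, t2⟩ := pair hpq hrp'.symm hrq'.symm h hr'
    have h0 : C r r' = 0 := by
      by_contra h0
      have := (pair (p := r') (q := r) (r := q) (Ne.symm hrr) hrq' hrq
        (by rw [hsymm]; exact neg_ne_zero.2 h0) (by rw [hsymm, hr, neg_zero])).1
      rw [hsymm, hr', neg_zero] at this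
      exact this rfl
    exact (cond hrq.symm hrq'.symm hrr).2 hr' h0 t2 (t1.symm.trans t2)
  have hCqp : C q p ≠ 0 := by rw [hsymm]; exact neg_ne_zero.2 hCpq
  -- Only finitely many directions are excluded, so some `r` makes all three of `C p q`, `C p r`, `C
  -- q r` nonzero.
  obtain ⟨r, hr⟩ := ((((Set.finite_singleton p).insert q).union (subsing hpq hCpq).finite).union
    (subsing hpq.symm hCqp).finite).infinite_compl.nonempty
  simp only [Set.mem_compl_iff, Set.mem_union, Set.mem_insert_iff, Set.mem_singleton_iff,
    Set.mem_ofPred_eq, not_or, not_and] at hr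
  obtain ⟨⟨⟨hrq, hrp⟩, hqr⟩, hpr⟩ := hr
  have hCqr := hqr hrp hrq
  have hCpr := hpr hrq hrp
  have hp : s2 p = s1 p := eq_of_ne (Ne.symm hrq) hpq.symm hrp hCqr hCqp
    (by rw [hsymm]; exact neg_ne_zero.2 hCpr)
  have hq : s2 q = s1 q := eq_of_ne (Ne.symm hrp) hpq hrq hCpr hCpq
    (by rw [hsymm]; exact neg_ne_zero.2 hCqr)
  have hall : ∀ r, s2 r = s1 r := by
    intro r
    by_cases hrp : r = p
    · rw [hrp, hp]
    by_cases hrq : r = q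
    · rw [hrq, hq]
    by_cases hqr : C q r = 0
    · have := (pair hpq (Ne.symm hrp) (Ne.symm hrq) hCpq hqr).2.1
      rw [hq] at this
      exact (mul_left_cancel₀ (h1 q) this).symm
    by_cases hpr : C p r = 0
    · have := (pair hpq.symm (Ne.symm hrq) (Ne.symm hrp) hCqp hpr).2.1
      rw [hp] at this
      exact (mul_left_cancel₀ (h1 p) this).symm
    exact eq_of_ne hpq (Ne.symm hrp) (Ne.symm hrq) hCpq hpr hqr
  refine ⟨hall, ?_⟩
  simp only [hall] at cond rel
  -- If `s1 ^ 2` agrees at `p` and `q`, it is constant. If not, the cube conditions determine `C p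
  -- r`, and with it `s0 r`, in terms of `s1 r`.
  by_cases ht : s1 p ^ 2 = s1 q ^ 2
  · left
    have hconst : ∀ r, s1 r ^ 2 = s1 p ^ 2 := by
      intro r
      by_cases hrp : r = p
      · rw [hrp]
      by_cases hrq : r = q
      · rw [hrq, ht]
      have e1 := rel hpq (Ne.symm hrp) (Ne.symm hrq) hCpq
      have e2 := ((cond hpq (Ne.symm hrp) (Ne.symm hrq)).1 hCpq).1
      have : (s1 p ^ 2 - s1 r ^ 2) * (s1 p * s1 q * C p q) = 0 := by
        linear_combination (s1 p ^ 2 - s1 r ^ 2) * e2 + s1 r * e1 + s1 r * s1 p * C p r * ht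
      have := (mul_eq_zero.1 this).resolve_right
        (mul_ne_zero (mul_ne_zero (h1 p) (h1 q)) hCpq)
      linear_combination -this
    exact fun r r' => (hconst r).trans (hconst r').symm
  · right
    have ht' := sub_ne_zero.2 ht
    have hp0 := h1 p
    have hq0 := h1 q
    have hlam : ∀ r, s1 r * C p r * (s1 p ^ 2 - s1 q ^ 2) =
        s1 q * C p q * (s1 p ^ 2 - s1 r ^ 2) := by
      intro r
      by_cases hrp : r = p
      · rw [hrp, sub_self, mul_zero, show C p p = 0 by rw [hC]; ring, mul_zero, zero_mul]
      by_cases hrq : r = q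
      · rw [hrq]
      have e1 := rel hpq (Ne.symm hrp) (Ne.symm hrq) hCpq
      have e2 := ((cond hpq (Ne.symm hrp) (Ne.symm hrq)).1 hCpq).1
      apply mul_left_cancel₀ hp0
      linear_combination -(s1 p ^ 2 - s1 r ^ 2) * e2 - s1 r * e1
    -- The constants come from solving `hlam` for `s0 r`, with `C p r = 2 * (s0 r * s1 p - s0 p * s1
    -- r)`.
    refine ⟨s0 p / s1 p - s1 q * C p q / (2 * s1 p * (s1 p ^ 2 - s1 q ^ 2)),
      s1 p * (s1 q * C p q) / (2 * (s1 p ^ 2 - s1 q ^ 2)), fun r => ?_⟩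
    have h := hlam r
    rw [show C p r = 2 * (s0 r * s1 p - s0 p * s1 r) by rw [hC, hall, hall]; ring] at h
    have hr0 := h1 r
    generalize s1 q * C p q = l at *
    generalize s1 p ^ 2 - s1 q ^ 2 = m at *
    field_simp
    linear_combination h

/-! ### Site-dependent changes of the fields -/

/-- The multiplicative function of the lattice sites with the factor `γ p` in the direction `p`. -/
noncomputable def siteProd {Λ : Type*} (γ : Λ → ℂ) (x : Λ →₀ ℤ) : ℂ := x.prod fun p n => γ p ^ n

section SiteProd

variable {Λ : Type*} {γ : Λ → ℂ}

theorem siteProd_ne_zero (hγ : ∀ p, γ p ≠ 0) (x : Λ →₀ ℤ) : siteProd γ x ≠ 0 :=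
  Finset.prod_ne_zero_iff.2 fun p _ => zpow_ne_zero _ (hγ p)

theorem siteProd_add_single (hγ : ∀ p, γ p ≠ 0) (x : Λ →₀ ℤ) (p : Λ) :
    siteProd γ (x + Finsupp.single p 1) = siteProd γ x * γ p := by
  rw [siteProd, Finsupp.prod_add_index' (fun p => zpow_zero _) (fun p m n => zpow_add₀ (hγ p) m n),
    Finsupp.prod_single_index (zpow_zero _), zpow_one, siteProd]

theorem siteProd_sq (hγ : ∀ p, γ p ^ 2 = 1) (x : Λ →₀ ℤ) : siteProd γ x ^ 2 = 1 := by
  rw [siteProd, Finsupp.prod, ← Finset.prod_pow]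
  refine Finset.prod_eq_one fun p _ => ?_
  rw [← zpow_natCast, zpow_comm, zpow_natCast, hγ, one_zpow]

end SiteProd

/-- A change of the fields that multiplies `h` on the edges by factors `m(x) m(x + e)` multiplies
`productEq` by a factor. -/
theorem multiple_of_gauge {Λ : Type*} {h h' : Λ → ℂ → ℂ → ℂ} {Q Q' : QuadFn}
    (φ : (Λ →₀ ℤ) → ℂ → ℂ) {m : (Λ →₀ ℤ) → ℂ} (hm : ∀ x, m x ≠ 0)
    (hg : ∀ x p u u1, h p (φ x u) (φ (x + Finsupp.single p 1) u1) =
      m x * m (x + Finsupp.single p 1) * h' p u u1)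
    {p q : Λ} (hQ : IsNonzeroMultiple Q (productEq (h p) (h q)))
    (hQ' : IsNonzeroMultiple Q' (productEq (h' p) (h' q))) (x : Λ →₀ ℤ) :
    IsNonzeroMultiple (fun u u1 u2 u12 => Q (φ x u) (φ (x + Finsupp.single p 1) u1)
      (φ (x + Finsupp.single q 1) u2) (φ (x + Finsupp.single p 1 + Finsupp.single q 1) u12)) Q' := by
  refine IsNonzeroMultiple.trans ?_ hQ'.symm
  obtain ⟨κ, hκ, h1⟩ := hQ
  refine ⟨κ * (m x * m (x + Finsupp.single p 1) * m (x + Finsupp.single q 1) *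
    m (x + Finsupp.single p 1 + Finsupp.single q 1)), by simp [hκ, hm], fun u u1 u2 u12 => ?_⟩
  -- Opposite edges together contain all four vertices, so both products acquire the same factor.
  -- The two routes to the far vertex are identified by commutativity of addition.
  simp only [h1, productEq, hg x]
  rw [hg (x + Finsupp.single p 1) q, add_right_comm x, hg (x + Finsupp.single q 1) p]
  ring

/-- The conditions `g0`, `g1`, `g2` multiply `h` on an edge by `c(x) c(x + e)`, which settles the
edge relation and the `u`-equation. The `U`-equation is not a product equation of an edge function
here, and its coefficients have to be compared one by one. -/
theorem gaugeEquiv_of_linear {Λ : Type*} {h h' : Λ → ℂ → ℂ → ℂ} {Q Q' F F' : Λ → Λ → QuadFn}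
    {s0 s1 s2 s0' s1' s2' : Λ → ℂ} (h1 : ∀ p, s1 p ≠ 0) (h2 : ∀ p, s2 p ≠ 0)
    (h1' : ∀ p, s1' p ≠ 0) (h2' : ∀ p, s2' p ≠ 0)
    (hh : ∀ p u u1, h p u u1 = s0 p + s1 p * u + s2 p * u1)
    (hh' : ∀ p u u1, h' p u u1 = s0' p + s1' p * u + s2' p * u1)
    (hQ : ∀ p q, p ≠ q → IsNonzeroMultiple (Q p q) (productEq (h p) (h q)))
    (hF : ∀ p q, p ≠ q → IsNonzeroMultiple (F p q)
      (linearEq (s0 p) (s1 p) (s2 p) (s0 q) (s1 q) (s2 q)))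
    (hQ' : ∀ p q, IsNonzeroMultiple (Q' p q) (productEq (h' p) (h' q)))
    (hF' : ∀ p q, IsNonzeroMultiple (F' p q)
      (linearEq (s0' p) (s1' p) (s2' p) (s0' q) (s1' q) (s2' q)))
    {a b c : (Λ →₀ ℤ) → ℂ} (ha : ∀ x, a x ≠ 0) (hc : ∀ x, c x ≠ 0)
    (g1 : ∀ x p, s1 p * a x = c x * c (x + Finsupp.single p 1) * s1' p)
    (g2 : ∀ x p, s2 p * a (x + Finsupp.single p 1) =
      c x * c (x + Finsupp.single p 1) * s2' p)
    (g0 : ∀ x p, s0 p + s1 p * b x + s2 p * b (x + Finsupp.single p 1) =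
      c x * c (x + Finsupp.single p 1) * s0' p) :
    (Triplet.ofH h Q F).GaugeEquiv (Triplet.ofH h' Q' F') := by
  have hg : ∀ x p u u1, h p (a x * u + b x)
      (a (x + Finsupp.single p 1) * u1 + b (x + Finsupp.single p 1)) =
      c x * c (x + Finsupp.single p 1) * h' p u u1 := by
    intro x p u u1
    rw [hh, hh']
    linear_combination g0 x p + u * g1 x p + u1 * g2 x p
  refine ⟨a, b, c, ha, hc, fun x p u u1 U U1 => ?_, fun x p q hpq => ?_, fun x p q hpq => ?_⟩
  · simp only [Triplet.ofH]
    rw [hg, show c x * U * (c (x + Finsupp.single p 1) * U1) =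
      c x * c (x + Finsupp.single p 1) * (U * U1) by ring]
    exact mul_right_inj' (mul_ne_zero (hc _) (hc _))
  · exact multiple_of_gauge (fun x u => a x * u + b x) hc hg (hQ p q hpq) (hQ' p q) x
  · refine IsNonzeroMultiple.trans (H := linearEq (s0' p) (s1' p) (s2' p) (s0' q) (s1' q) (s2' q))
      ?_ (hF' p q).symm
    obtain ⟨κ, hκ, hκF⟩ := hF p q hpq
    have e1 := g1 x p
    have e2 := g1 x q
    have e3 := g1 (x + Finsupp.single q 1) p
    have e4 := g1 (x + Finsupp.single p 1) q
    have f1 := g2 x p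
    have f2 := g2 x q
    have f3 := g2 (x + Finsupp.single q 1) p
    have f4 := g2 (x + Finsupp.single p 1) q
    have k1 := g0 x p
    have k2 := g0 x q
    have k3 := g0 (x + Finsupp.single q 1) p
    have k4 := g0 (x + Finsupp.single p 1) q
    rw [add_right_comm x (Finsupp.single q 1)] at f3 k3
    rw [add_right_comm x (Finsupp.single q 1)] at e3
    have p1 := h1 p
    have q1 := h1 q
    have p2 := h2 p
    have q2 := h2 q
    have p1' := h1' p
    have q1' := h1' q
    have p2' := h2' p
    have q2' := h2' q
    have hcx := hc x
    have hcp := hc (x + Finsupp.single p 1)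
    have hcq := hc (x + Finsupp.single q 1)
    have hcpq := hc (x + Finsupp.single p 1 + Finsupp.single q 1)
    have hax := ha x
    have haq := ha (x + Finsupp.single q 1)
    have hap := ha (x + Finsupp.single p 1)
    have hapq := ha (x + Finsupp.single p 1 + Finsupp.single q 1)
    have hb : ∀ U U1 U2 U12 : ℂ, F p q (c x * U) (c (x + Finsupp.single p 1) * U1)
        (c (x + Finsupp.single q 1) * U2)
        (c (x + Finsupp.single p 1 + Finsupp.single q 1) * U12) =
      κ * linearEq (s0 p) (s1 p) (s2 p) (s0 q) (s1 q) (s2 q) (c x * U)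
        (c (x + Finsupp.single p 1) * U1) (c (x + Finsupp.single q 1) * U2)
        (c (x + Finsupp.single p 1 + Finsupp.single q 1) * U12) := fun _ _ _ _ => hκF _ _ _ _
    refine ⟨κ * (s1 p * s1 q * a x / (s1' p * s1' q)), by
      simp [hκ, h1, h1', ha], fun U U1 U2 U12 => (hb U U1 U2 U12).trans ?_⟩
    rw [mul_assoc]
    congr 1
    generalize a x = a0, a (x + Finsupp.single p 1) = a1, a (x + Finsupp.single q 1) = a2,
      a (x + Finsupp.single p 1 + Finsupp.single q 1) = a12, c x = c0,
      c (x + Finsupp.single p 1) = c1, c (x + Finsupp.single q 1) = c2,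
      c (x + Finsupp.single p 1 + Finsupp.single q 1) = c12, b x = b0,
      b (x + Finsupp.single p 1) = b1, b (x + Finsupp.single q 1) = b2,
      b (x + Finsupp.single p 1 + Finsupp.single q 1) = b12 at *
    set μ := s1 p * s1 q * a0 / (s1' p * s1' q) with hμ
    -- The four quadratic coefficients scale by one and the same `μ`: `m1` and `m2` are read off at
    -- the base vertex, and `hμ2` carries `μ` along the edges to the far vertex, for `m3` and `m4`.
    have m1 : s1 q * (c0 * c1) = μ * s1' q := by
      rw [hμ]
      field_simp
      linear_combination -e1
    have m2 : s1 p * (c0 * c2) = μ * s1' p := by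
      rw [hμ]
      field_simp
      linear_combination -e2
    have hμ2 : s2 p * s2 q * a12 = μ * (s2' p * s2' q) := by
      rw [hμ]
      field_simp
      linear_combination s2 q * s1' q * (s1' p * f3 - s2' p * e3)
        + s2' p * s1 p * (s1' q * f2 - s2' q * e2)
    have m3 : s2 q * (c2 * c12) = μ * s2' q := by
      apply mul_right_cancel₀ p2'
      linear_combination hμ2 - s2 q * f3
    have m4 : s2 p * (c1 * c12) = μ * s2' p := by
      apply mul_right_cancel₀ q2'
      linear_combination hμ2 - s2 p * f4
    simp only [linearEq]
    -- For the constant term, the relations `g0` on the four edges are combined with the weights of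
    -- the elimination of `u`, so that the translations `b` cancel.
    linear_combination U * U1 * m1 + U2 * U12 * m3 - U * U2 * m2 - U1 * U12 * m4
      - s1 q * k1 + s1 p * k2 - s2 q * k3 + s2 p * k4 - s0' p * (m1 + m3) + s0' q * (m2 + m4)

/-- The dual function is multiplied by `a(x) a(x + e)`, so `multiple_of_gauge` also handles the
`U`-equation, with `a` and `c` in exchanged roles. -/
theorem gaugeEquiv_of_bilinear {Λ : Type*} {h h' : Λ → ℂ → ℂ → ℂ} {Q Q' F F' : Λ → Λ → QuadFn}
    {s0 s3 s0' s3' : Λ → ℂ} (h3 : ∀ p, s3 p ≠ 0) (h3' : ∀ p, s3' p ≠ 0)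
    (hh : ∀ p u u1, h p u u1 = s0 p + s3 p * u * u1)
    (hh' : ∀ p u u1, h' p u u1 = s0' p + s3' p * u * u1)
    (hQ : ∀ p q, p ≠ q → IsNonzeroMultiple (Q p q) (productEq (h p) (h q)))
    (hF : ∀ p q, p ≠ q → IsNonzeroMultiple (F p q)
      (productEq (bilinearDual (s0 p) (s3 p)) (bilinearDual (s0 q) (s3 q))))
    (hQ' : ∀ p q, IsNonzeroMultiple (Q' p q) (productEq (h' p) (h' q)))
    (hF' : ∀ p q, IsNonzeroMultiple (F' p q)
      (productEq (bilinearDual (s0' p) (s3' p)) (bilinearDual (s0' q) (s3' q))))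
    {a c : (Λ →₀ ℤ) → ℂ} (ha : ∀ x, a x ≠ 0) (hc : ∀ x, c x ≠ 0)
    (g0 : ∀ x p, s0 p = c x * c (x + Finsupp.single p 1) * s0' p)
    (g3 : ∀ x p, s3 p * (a x * a (x + Finsupp.single p 1)) =
      c x * c (x + Finsupp.single p 1) * s3' p) :
    (Triplet.ofH h Q F).GaugeEquiv (Triplet.ofH h' Q' F') := by
  have hg : ∀ x p u u1, h p (a x * u + 0) (a (x + Finsupp.single p 1) * u1 + 0) =
      c x * c (x + Finsupp.single p 1) * h' p u u1 := by
    intro x p u u1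
    rw [hh, hh']
    linear_combination g0 x p + u * u1 * g3 x p
  have hk : ∀ x p U U1, bilinearDual (s0 p) (s3 p) (c x * U) (c (x + Finsupp.single p 1) * U1) =
      a x * a (x + Finsupp.single p 1) * bilinearDual (s0' p) (s3' p) U U1 := by
    intro x p U U1
    have e1 := h3 p
    have e2 := h3' p
    simp only [bilinearDual]
    field_simp
    linear_combination -s3' p * g0 x p - (U * U1 - s0' p) * g3 x p
  refine ⟨a, fun _ => 0, c, ha, hc, fun x p u u1 U U1 => ?_, fun x p q hpq => ?_,
    fun x p q hpq => ?_⟩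
  · simp only [Triplet.ofH]
    rw [hg, show c x * U * (c (x + Finsupp.single p 1) * U1) =
      c x * c (x + Finsupp.single p 1) * (U * U1) by ring]
    exact mul_right_inj' (mul_ne_zero (hc _) (hc _))
  · exact multiple_of_gauge (fun x u => a x * u + 0) hc hg (hQ p q hpq) (hQ' p q) x
  · exact multiple_of_gauge (h := fun p => bilinearDual (s0 p) (s3 p))
      (h' := fun p => bilinearDual (s0' p) (s3' p)) (fun x u => c x * u) ha hk (hF p q hpq)
      (hF' p q) x

/-! ### Reduction to the list -/

theorem exists_sq_eq (z : ℂ) : ∃ w : ℂ, w ^ 2 = z := IsAlgClosed.exists_pow_nat_eq z two_pos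

theorem exists_row_of_linear {Λ : Type*} [Infinite Λ] {h : Λ → ℂ → ℂ → ℂ}
    {Q F : Λ → Λ → QuadFn} {s0 s1 s2 : Λ → ℂ} (h1 : ∀ p, s1 p ≠ 0) (h2 : ∀ p, s2 p ≠ 0)
    (hh : ∀ p u u1, h p u u1 = s0 p + s1 p * u + s2 p * u1)
    (hQ : ∀ p q, p ≠ q → IsNonzeroMultiple (Q p q) (productEq (h p) (h q)))
    (hF : ∀ p q, p ≠ q → IsNonzeroMultiple (F p q)
      (linearEq (s0 p) (s1 p) (s2 p) (s0 q) (s1 q) (s2 q)))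
    (hcac : ConsistentAroundCube F) :
    ∃ (π : Λ → ℂ) (h' : Λ → ℂ → ℂ → ℂ) (Q' F' : Λ → Λ → QuadFn), TableRow π h' Q' F' ∧
      (Triplet.ofH h Q F).GaugeEquiv (Triplet.ofH h' Q' F') := by
  rcases linear_classification h1 h2 (hcac.of_multiple hF) with h0 | ⟨h21, h0 | ⟨k, μ, h0⟩⟩
  -- Entry 1 needs opposite coefficients of `u` and `ũ`. So `a` must change by `-s1 p / s2 p` along
  -- an edge; it is the square of `siteProd γ`, which serves as `c`.
  · choose γ hγ using fun p => exists_sq_eq (-s1 p / s2 p)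
    have hγ0 : ∀ p, γ p ≠ 0 := fun p hp => by
      have := hγ p
      rw [hp, zero_pow two_ne_zero, eq_comm, div_eq_zero_iff, neg_eq_zero] at this
      exact this.elim (h1 p) (h2 p)
    have hπ : ∀ p, γ p / s1 p ≠ 0 := fun p => div_ne_zero (hγ0 p) (h1 p)
    obtain ⟨b, hb⟩ : ∃ b : (Λ →₀ ℤ) → ℂ, ∀ x p,
        s0 p + s1 p * b x + s2 p * b (x + Finsupp.single p 1) = 0 := by
      -- If `s1 + s2` vanishes identically, the translation has to grow by `s0 p / s1 p` at each
      -- step. Otherwise a constant works, because `s0` is proportional to `s1 + s2`.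
      by_cases hw : ∀ p, s1 p + s2 p = 0
      · refine ⟨fun x => x.sum fun p n => n * (s0 p / s1 p), fun x p => ?_⟩
        simp only
        rw [Finsupp.sum_add_index' (by simp) (fun p m n => by push_cast; ring),
          Finsupp.sum_single_index (by simp), Int.cast_one, one_mul, mul_add,
          eq_neg_of_add_eq_zero_right (hw p)]
        have := h1 p
        field_simp
        ring
      · push Not at hw
        obtain ⟨q, hq⟩ := hw
        refine ⟨fun _ => -(s0 q / (s1 q + s2 q)), fun _ p => ?_⟩
        field_simp
        linear_combination -h0 p q
    refine ⟨fun p => γ p / s1 p, _, _, _, .no1 hπ,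
      gaugeEquiv_of_linear h1 h2 (s0' := fun _ => 0) (s1' := fun p => 1 / (γ p / s1 p))
        (s2' := fun p => -(1 / (γ p / s1 p))) (by simp [h1, hγ0]) (by simp [h1, hγ0]) hh
        (fun p u u1 => by ring) hQ hF (fun p q => multiple_no1_u (hπ p) (hπ q))
        (fun p q => multiple_no1_U (hπ p) (hπ q)) (a := fun x => siteProd γ x ^ 2) (b := b)
        (c := siteProd γ) (fun x => pow_ne_zero 2 (siteProd_ne_zero hγ0 x))
        (siteProd_ne_zero hγ0) (fun x p => ?_) (fun x p => ?_) fun x p => by simp [hb]⟩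
    · rw [siteProd_add_single hγ0]
      have := hγ0 p
      have := h1 p
      field_simp
    · rw [siteProd_add_single hγ0, mul_pow, hγ]
      have := hγ0 p
      have := h1 p
      have := h2 p
      field_simp
  -- Here `s1` is constant up to signs. The signs go into `siteProd`, whose square is 1, so that
  -- `c(x) c(x + e) = s1 p`.
  · obtain ⟨q⟩ : Nonempty Λ := inferInstance
    obtain ⟨c, hc⟩ := exists_sq_eq (s1 q)
    have hc0 : c ≠ 0 := by
      rintro rfl
      exact h1 q (by rw [← hc, zero_pow two_ne_zero])
    have hε : ∀ p, (s1 p / s1 q) ^ 2 = 1 := fun p => by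
      rw [div_pow, h0 p q, div_self (pow_ne_zero 2 (h1 q))]
    have hε0 : ∀ p, s1 p / s1 q ≠ 0 := fun p => div_ne_zero (h1 p) (h1 q)
    have hcc : ∀ (x : Λ →₀ ℤ) p, c * siteProd (fun p => s1 p / s1 q) x *
        (c * siteProd (fun p => s1 p / s1 q) (x + Finsupp.single p 1)) = s1 p := fun x p => by
      rw [siteProd_add_single hε0]
      have := h1 q
      linear_combination (c ^ 2 * (s1 p / s1 q)) * siteProd_sq hε x + (s1 p / s1 q) * hc
        + div_mul_cancel₀ (s1 p) this
    refine ⟨fun p => s0 p / s1 p, _, _, _, .no2,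
      gaugeEquiv_of_linear h1 h2 (s0' := fun p => s0 p / s1 p) (s1' := fun _ => 1)
        (s2' := fun _ => 1) (by simp) (by simp) hh (fun p u u1 => by ring) hQ hF
        (fun p q => multiple_no2_u _ _) (fun p q => multiple_no2_U _ _) (a := fun _ => 1)
        (b := fun _ => 0) (c := fun x => c * siteProd (fun p => s1 p / s1 q) x) (by simp)
        (fun x => mul_ne_zero hc0 (siteProd_ne_zero hε0 x)) (fun x p => by rw [hcc])
        (fun x p => by rw [hcc, h21]) fun x p => ?_⟩
    rw [hcc, mul_div_cancel₀ _ (h1 p)]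
    ring
  -- The translation by `-k / 2` removes the term `k * s1 p`, leaving `μ / s1 p`, which is `-(δ * π
  -- p)` for `δ = -μ` and `π p = 1 / s1 p`.
  · have hπ : ∀ p, 1 / s1 p ≠ 0 := fun p => one_div_ne_zero (h1 p)
    refine ⟨fun p => 1 / s1 p, _, _, _, .no3 (-μ) hπ,
      gaugeEquiv_of_linear h1 h2 (s0' := fun p => -(-μ * (1 / s1 p)))
        (s1' := fun p => 1 / (1 / s1 p)) (s2' := fun p => 1 / (1 / s1 p)) (by simp [h1])
        (by simp [h1]) hh (fun p u u1 => ?_) hQ hF (fun p q => multiple_no3_u _ (hπ p) (hπ q))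
        (fun p q => multiple_no3_U _ (hπ p) (hπ q)) (a := fun _ => 1) (b := fun _ => -k / 2)
        (c := fun _ => 1) (by simp) (by simp) (by simp) (by simp [h21]) fun x p => ?_⟩
    · have := h1 p
      field_simp
      ring
    · rw [h0, h21]
      ring

/-- Points in the plane any three of which are collinear lie on one line. -/
theorem exists_line {Λ : Type*} {a c : Λ → ℂ} (hcol : ∀ p q r, p ≠ q → p ≠ r → q ≠ r →
    (a p - a r) * (c q - c r) = (a q - a r) * (c p - c r)) :
    ∃ α β γ : ℂ, (α ≠ 0 ∨ β ≠ 0) ∧ ∀ p, α * a p + β * c p = γ := by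
  by_cases hconst : ∀ p q, a p = a q ∧ c p = c q
  · rcases isEmpty_or_nonempty Λ with hΛ | ⟨⟨q⟩⟩
    · exact ⟨1, 0, 0, by simp, fun p => hΛ.elim p⟩
    · exact ⟨0, 1, c q, by simp, fun p => by simp [(hconst p q).2]⟩
  · push Not at hconst
    obtain ⟨p, q, hpq⟩ := hconst
    refine ⟨c p - c q, -(a p - a q), (c p - c q) * a q - (a p - a q) * c q, ?_, fun r => ?_⟩
    · by_cases h : a p = a q
      · exact .inl (sub_ne_zero.2 (hpq h))
      · exact .inr (neg_ne_zero.2 (sub_ne_zero.2 h))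
    · have hne : p ≠ q := by
        rintro rfl
        exact hpq rfl rfl
      by_cases hrp : r = p
      · subst hrp
        ring
      by_cases hrq : r = q
      · subst hrq
        ring
      linear_combination hcol r p q hrp hrq hne

theorem bilinearDual_bilinearDual {s0 s3 : ℂ} (h3 : s3 ≠ 0) (u u1 : ℂ) :
    bilinearDual (-(s0 / s3)) (1 / s3) u u1 = s0 + s3 * u * u1 := by
  rw [bilinearDual]
  field_simp
  ring

theorem Triplet.ofH_swap_bilinear {Λ : Type*} {h : Λ → ℂ → ℂ → ℂ} {Q F : Λ → Λ → QuadFn}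
    {s0 s3 : Λ → ℂ} (h3 : ∀ p, s3 p ≠ 0) (hh : ∀ p u u1, h p u u1 = s0 p + s3 p * u * u1) :
    (Triplet.ofH h Q F).swap = Triplet.ofH (fun p => bilinearDual (s0 p) (s3 p)) F Q := by
  simp only [Triplet.ofH, Triplet.swap, Triplet.mk.injEq, and_true]
  funext p U U1 u u1
  rw [hh, eq_iff_iff]
  exact bilinear_edge_iff (h3 p) u u1 U U1

theorem exists_row_of_bilinear {Λ : Type*} {h : Λ → ℂ → ℂ → ℂ}
    {Q F : Λ → Λ → QuadFn} {s0 s3 : Λ → ℂ} (h0 : ∀ p, s0 p ≠ 0) (h3 : ∀ p, s3 p ≠ 0)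
    (hh : ∀ p u u1, h p u u1 = s0 p + s3 p * u * u1)
    (hQ : ∀ p q, p ≠ q → IsNonzeroMultiple (Q p q) (productEq (h p) (h q)))
    (hF : ∀ p q, p ≠ q → IsNonzeroMultiple (F p q)
      (productEq (bilinearDual (s0 p) (s3 p)) (bilinearDual (s0 q) (s3 q))))
    (hcac : ConsistentAroundCube Q) :
    ∃ π : Λ → ℂ,
      (∃ (h' : Λ → ℂ → ℂ → ℂ) (Q' F' : Λ → Λ → QuadFn), TableRow π h' Q' F' ∧
        (Triplet.ofH h Q F).GaugeEquiv (Triplet.ofH h' Q' F')) ∨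
      ((∀ p, π p ≠ 0) ∧ (Triplet.ofH h Q F).swap.GaugeEquiv
        (Triplet.ofH (fun p u u1 => 1 / π p * (u * u1 - 1))
          (fun p q => eqNew (π p) (π q)) (fun p q => eqH3Inv (π p) (π q)))) := by
  -- a function with constant square is turned into a constant by a change of the field
  have sign : ∀ s : Λ → ℂ, (∀ p, s p ≠ 0) → (∀ p q, s p ^ 2 = s q ^ 2) →
      ∃ a : (Λ →₀ ℤ) → ℂ, (∀ x, a x ≠ 0) ∧ ∀ x p, a x * a (x + Finsupp.single p 1) = s p := by
    intro s hs hsq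
    rcases isEmpty_or_nonempty Λ with hΛ | ⟨⟨q⟩⟩
    · exact ⟨fun _ => 1, by simp, fun _ p => hΛ.elim p⟩
    obtain ⟨c, hc⟩ := exists_sq_eq (s q)
    have hc0 : c ≠ 0 := by
      rintro rfl
      exact hs q (by rw [← hc, zero_pow two_ne_zero])
    have hε : ∀ p, (s p / s q) ^ 2 = 1 := fun p => by
      rw [div_pow, hsq p q, div_self (pow_ne_zero 2 (hs q))]
    have hε0 : ∀ p, s p / s q ≠ 0 := fun p => div_ne_zero (hs p) (hs q)
    refine ⟨fun x => c * siteProd (fun p => s p / s q) x,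
      fun x => mul_ne_zero hc0 (siteProd_ne_zero hε0 x), fun x p => ?_⟩
    simp only
    rw [siteProd_add_single hε0]
    linear_combination (c ^ 2 * (s p / s q)) * siteProd_sq hε x + (s p / s q) * hc
      + div_mul_cancel₀ (s p) (hs q)
  obtain ⟨α, β, γ, hαβ, hline⟩ := exists_line (a := fun p => s0 p ^ 2) (c := fun p => s3 p ^ 2)
    fun p q r hpq hpr hqr =>
      bilinear_cube_condition h0 h3 hh (hcac.of_multiple hQ) hpq hpr hqr
  -- `s3 ^ 2` is constant: scaling `u` makes `s3 = 1`, which is entry 4 with `δ = 1`.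
  by_cases hα : α = 0
  · have hβ : β ≠ 0 := hαβ.resolve_left (not_not.2 hα)
    obtain ⟨a, ha, haa⟩ := sign (fun p => 1 / s3 p) (fun p => one_div_ne_zero (h3 p)) fun p q => by
      have : s3 p ^ 2 = s3 q ^ 2 := mul_left_cancel₀ hβ (by
        linear_combination hline p - hline q - (s0 p ^ 2 - s0 q ^ 2) * hα)
      simp only [div_pow, this]
    refine ⟨s0, .inl ⟨_, _, _, .no4 1 one_ne_zero h0,
      gaugeEquiv_of_bilinear (s0' := fun p => 1 * s0 p) (s3' := fun _ => 1) h3 (by simp) hh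
        (fun p u u1 => by ring) hQ hF (fun p q => multiple_no4_u _ _ one_ne_zero)
        (fun p q => multiple_no4_U _ _ one_ne_zero) ha (c := fun _ => 1) (by simp) (by simp)
        fun x p => ?_⟩⟩
    rw [haa, mul_one_div_cancel (h3 p)]
    simp
  -- `s0 ^ 2` is constant: scaling `U` by `a` with `a(x) a(x + e) = s0 p` turns the dual system into
  -- entry 5.
  by_cases hβ : β = 0
  · obtain ⟨a, ha, haa⟩ := sign s0 h0 fun p q => mul_left_cancel₀ hα (by
      linear_combination hline p - hline q - (s3 p ^ 2 - s3 q ^ 2) * hβ)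
    have hπ : ∀ p, s3 p / s0 p ≠ 0 := fun p => div_ne_zero (h3 p) (h0 p)
    refine ⟨fun p => s3 p / s0 p, .inr ⟨hπ, ?_⟩⟩
    rw [Triplet.ofH_swap_bilinear h3 hh]
    refine gaugeEquiv_of_bilinear (s0 := fun p => -(s0 p / s3 p)) (s3 := fun p => 1 / s3 p)
      (s0' := fun p => -(1 / (s3 p / s0 p))) (s3' := fun p => 1 / (s3 p / s0 p))
      (fun p => one_div_ne_zero (h3 p)) (fun p => one_div_ne_zero (hπ p))
      (fun p u u1 => by rw [bilinearDual]; ring) (fun p u u1 => by ring) hF (fun p q hpq => ?_)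
      (fun p q => multiple_no5_u (hπ p) (hπ q)) (fun p q => multiple_no5_U (hπ p) (hπ q)) ha
      (c := fun _ => 1) (by simp) (by simp) fun x p => ?_
    · have : ∀ p, bilinearDual (-(s0 p / s3 p)) (1 / s3 p) = h p := fun p => by
        funext u u1
        rw [bilinearDual_bilinearDual (h3 p), hh]
      simpa only [this] using hQ p q hpq
    · rw [haa]
      have := h3 p
      have := h0 p
      field_simp
  -- `s0 ^ 2 / s3 ^ 2` is constant: scaling `u` gives `s0 p * (1 - u ũ)`, which is entry 5 with `π p
  -- = -1 / s0 p`.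
  by_cases hγ : γ = 0
  · obtain ⟨a, ha, haa⟩ := sign (fun p => -s0 p / s3 p)
      (fun p => div_ne_zero (neg_ne_zero.2 (h0 p)) (h3 p)) fun p q => by
        have e1 := h3 p
        have e2 := h3 q
        field_simp
        apply mul_left_cancel₀ hα
        linear_combination s3 q ^ 2 * (hline p) - s3 p ^ 2 * hline q
          + (s3 q ^ 2 - s3 p ^ 2) * hγ
    have hπ : ∀ p, -1 / s0 p ≠ 0 := fun p => div_ne_zero (by simp) (h0 p)
    refine ⟨fun p => -1 / s0 p, .inl ⟨_, _, _, .no5 hπ,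
      gaugeEquiv_of_bilinear (s0' := fun p => -(1 / (-1 / s0 p)))
        (s3' := fun p => 1 / (-1 / s0 p)) h3 (fun p => one_div_ne_zero (hπ p)) hh
        (fun p u u1 => by ring) hQ hF (fun p q => multiple_no5_u (hπ p) (hπ q))
        (fun p q => multiple_no5_U (hπ p) (hπ q)) ha (c := fun _ => 1) (by simp)
        (fun x p => by simp [div_neg]) fun x p => ?_⟩⟩
    rw [haa]
    have := h3 p
    have := h0 p
    field_simp
  -- The line reads `s0 ^ 2 - A ^ 2 * s3 ^ 2 = C ^ 2`. Division by `s0 ^ 2` is the relation between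
  -- `σ` and `π` in entry 6, and the constant factors `√A` for `u` and `√C` for `U` suffice.
  · obtain ⟨A, hA⟩ := exists_sq_eq (-β / α)
    obtain ⟨C, hC⟩ := exists_sq_eq (γ / α)
    have hA0 : A ≠ 0 := fun h => by
      rw [h, zero_pow two_ne_zero, eq_comm, div_eq_zero_iff, neg_eq_zero] at hA
      exact hA.elim hβ hα
    have hC0 : C ≠ 0 := fun h => by
      rw [h, zero_pow two_ne_zero, eq_comm, div_eq_zero_iff] at hC
      exact hC.elim hγ hα
    obtain ⟨a, ha⟩ := exists_sq_eq A
    obtain ⟨c, hc⟩ := exists_sq_eq C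
    have ha0 : a ≠ 0 := fun h => hA0 (by rw [← ha, h, zero_pow two_ne_zero])
    have hc0 : c ≠ 0 := fun h => hC0 (by rw [← hc, h, zero_pow two_ne_zero])
    have hπ : ∀ p, -(s3 p * A / s0 p) ≠ 0 := fun p =>
      neg_ne_zero.2 (div_ne_zero (mul_ne_zero (h3 p) hA0) (h0 p))
    have hσ : ∀ p, C / s0 p ≠ 0 := fun p => div_ne_zero hC0 (h0 p)
    have hσπ : ∀ p, (C / s0 p) ^ 2 = 1 - (-(s3 p * A / s0 p)) ^ 2 := fun p => by
      have := h0 p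
      rw [neg_sq, div_pow, div_pow, mul_pow, hA, hC]
      field_simp
      linear_combination -hline p
    refine ⟨fun p => -(s3 p * A / s0 p), .inl ⟨_, _, _, .no6 (fun p => C / s0 p) hπ hσ hσπ,
      gaugeEquiv_of_bilinear (s0' := fun p => 1 / (C / s0 p))
        (s3' := fun p => -(-(s3 p * A / s0 p) / (C / s0 p))) h3
        (fun p => neg_ne_zero.2 (div_ne_zero (hπ p) (hσ p))) hh (fun p u u1 => by ring) hQ hF
        (fun p q => multiple_no6_u (hσ p) (hσ q) (hσπ p) (hσπ q))
        (fun p q => multiple_no6_U (hσ p) (hσ q) (hπ p) (hπ q) (hσπ p) (hσπ q))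
        (a := fun _ => a) (c := fun _ => c) (fun _ => ha0) (fun _ => hc0) (fun x p => ?_)
        fun x p => ?_⟩⟩
    · rw [← pow_two, hc]
      field_simp
    · have := h0 p
      rw [← pow_two, ← pow_two, ha, hc]
      field_simp

/-! ### Proof of the theorem -/

theorem theorem2 {Λ : Type*} :
    -- every entry of the list is a consistent triplet between equations that are CAC
    (∀ (π : Λ → ℂ) (h : Λ → ℂ → ℂ → ℂ) (Q F : Λ → Λ → QuadFn),
      Function.Injective π → TableRow π h Q F →
        (IsLinearForm h ∨ IsBilinearForm h) ∧
        (∀ p q, IsAffineLinear (Q p q)) ∧ (∀ p q, IsAffineLinear (F p q)) ∧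
        (Triplet.ofH h Q F).IsConsistent ∧
        ConsistentAroundCube Q ∧ TetrahedronProperty Q ∧
        ConsistentAroundCube F ∧ TetrahedronProperty F) ∧
    -- the list is exhaustive, if a system of the form of entry 5 may also be read with `u` and `U`
    -- interchanged
    (Infinite Λ → ∀ (h : Λ → ℂ → ℂ → ℂ) (Q F : Λ → Λ → QuadFn),
      (IsLinearForm h ∨ IsBilinearForm h) →
      (∀ p q, IsAffineLinear (Q p q)) → (∀ p q, IsAffineLinear (F p q)) →
      (Triplet.ofH h Q F).IsConsistent →
      ConsistentAroundCube Q → ConsistentAroundCube F →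
        ∃ π : Λ → ℂ,
          (∃ (h' : Λ → ℂ → ℂ → ℂ) (Q' F' : Λ → Λ → QuadFn), TableRow π h' Q' F' ∧
            (Triplet.ofH h Q F).GaugeEquiv (Triplet.ofH h' Q' F')) ∨
          ((∀ p, π p ≠ 0) ∧
            (Triplet.ofH h Q F).swap.GaugeEquiv
              (Triplet.ofH (fun p u u1 => 1 / π p * (u * u1 - 1))
                (fun p q => eqNew (π p) (π q)) (fun p q => eqH3Inv (π p) (π q))))) := by
  refine ⟨fun π h Q F hπ hrow => ?_, fun hΛ h Q F hform hQ hF hcons hcQ hcF => ?_⟩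
  · obtain ⟨⟨h1, h2⟩, ⟨h3, h4⟩, ⟨h5, h6⟩, h7, h8⟩ := hrow.isConsistent hπ
    exact ⟨h1, h3, h4, h2, h5, h6, h7, h8⟩
  · obtain ⟨hU, hu⟩ := hcons
    have hu := compatYields_swap_iff.1 hu
    rcases hform with ⟨s0, s1, s2, h1, h2, hh⟩ | ⟨s0, s3, h0, h3, hh⟩
    · simp only [Triplet.ofH, hh] at hU
      obtain ⟨π, h'⟩ := exists_row_of_linear h1 h2 hh
        (fun p q hpq => exists_proportional_productEq (a3 := 0) (b3 := 0)
          (.inl ⟨rfl, rfl, h1 p, h2 p, h1 q, h2 q⟩) (fun u v => by rw [hh]; ring)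
          (fun u v => by rw [hh]; ring) (hQ p q) (hu p q hpq))
        (fun p q hpq => isNonzeroMultiple_linearEq (h1 p) (h2 p) (h1 q) (hF p q)
          ((compatYields_linear_iff h1 h2).1 hU p q hpq)) hcF
      exact ⟨π, .inl h'⟩
    · simp only [Triplet.ofH, hh, bilinear_edge_iff (h3 _)] at hU
      -- The dual function is again bilinear with nonzero coefficients, so `F` is identified in the
      -- same way as `Q`.
      have hd : ∀ p U V, bilinearDual (s0 p) (s3 p) U V =
          -(s0 p / s3 p) + 0 * U + 0 * V + 1 / s3 p * U * V := fun p U V => by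
        rw [bilinearDual]
        ring
      have hd0 : ∀ p, -(s0 p / s3 p) ≠ 0 := fun p => neg_ne_zero.2 (div_ne_zero (h0 p) (h3 p))
      have hd3 : ∀ p, 1 / s3 p ≠ 0 := fun p => one_div_ne_zero (h3 p)
      exact exists_row_of_bilinear h0 h3 hh
        (fun p q hpq => exists_proportional_productEq (a1 := 0) (a2 := 0) (b1 := 0) (b2 := 0)
          (.inr ⟨rfl, rfl, rfl, rfl, h0 p, h3 p, h0 q, h3 q⟩) (fun u v => by rw [hh]; ring)
          (fun u v => by rw [hh]; ring) (hQ p q) (hu p q hpq))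
        (fun p q hpq => exists_proportional_productEq
          (.inr ⟨rfl, rfl, rfl, rfl, hd0 p, hd3 p, hd0 q, hd3 q⟩) (hd p) (hd q) (hF p q)
          (compatYields_swap_iff.1 hU p q hpq)) hcQ
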